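/- Let $N\ge 2$ and $k\in\{1,\dots,N-1\}$. For $s\ge 0$ let $(-\Delta)^{s}$ be the operator on $\mathbb R^N$ given by $\widehat{(-\Delta)^{s}g}(\xi)=(2\pi|\xi|)^{2s}\,\widehat g(\xi)$, where $\widehat g(\xi)=\int_{\mathbb R^N} g(x)e^{-2\pi i x\cdot\xi}\,dx$. For a smooth function $f$ on $\mathbb R^N$ let $|\nabla^k f|(x)$ be the Euclidean norm of the family of all $N^k$ partial derivatives $\partial^k f/\partial x_{i_1}\cdots\partial x_{i_k}$ ($i_1,\dots,i_k\in\{1,\dots,N\}$) at $x$. For $\alpha\in(0,N)$ put $$\gamma(\alpha)=\pi^{N/2}\,2^{\alpha}\,\frac{\Gamma(\alpha/2)}{\Gamma((N-\alpha)/2)}.$$ With the falling factorial $(\nu)_j=\nu(\nu-1)\cdots(\nu-j+1)$ (and $(\nu)_0=1$) and $\binom{\nu}{n}=(\nu)_n/n!$, put, for $s\in\mathbb R$ and integers $m\ge 1$, $$\lambda_N^{s,m}=m!\sum_{l=0}^{\lfloor m/2\rfloor}(m-2l)!\,l!\left(\tfrac{N-3}{2}+l\right)_l\left(\sum_{n=\lceil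 m/2\rceil}^{m-l}2^{2n-m+l}\binom{s/2}{n}\binom{n}{m-n}\binom{m-n}{l}\right)^2 ;$$ this is the constant for which $\bigl|\nabla^m |x|^s\bigr|^2=\lambda_N^{s,m}|x|^{-2(m-s)}$ for all $x\ne 0$. Set $$c_k=\left(\lambda_N^{k-N,k}\right)^{-1/2}\gamma(N-k)^{-1}.$$ Then for every real-valued $u\in C_c^\infty(\mathbb R^N)$ the function $(-\Delta)^{(N-k)/2}u$ is smooth, $|\nabla^k(-\Delta)^{(N-k)/2}u|$ is integrable on $\mathbb R^N$, and $$\sup_{x\in\mathbb R^N}|u(x)|\le c_k\int_{\mathbb R^N}\bigl|\nabla^k(-\Delta)^{(N-k)/2}u(x)\bigr|\,dx .$$ Furthermore, when $N-k$ is even, $c_k$ is optimal: for every real $C<c_k$ there is a real-valued $u\in C_c^\infty(\mathbb R^N)$ with $$\sup_{x\in\mathbb R^N}|u(x)|> C\int_{\mathbb R^N}\bigl|\nabla^k(-\Delta)^{(N-k)/2}u(x)\bigr|\,dx .$$ -/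

import Mathlib

open scoped FourierTransform ContDiff

noncomputable section

/-- The fractional Laplacian `(-Δ)^s` on `ℝ^N`, as the Fourier multiplier with symbol
`(2π|ξ|)^(2s)`; here `𝓕 f ξ = ∫ f(x) e^(-2πi⟨x,ξ⟩) dx` and `𝓕⁻` is the inverse transform. -/
def fracLaplacian {N : ℕ} (s : ℝ) (f : EuclideanSpace ℝ (Fin N) → ℂ) :
    EuclideanSpace ℝ (Fin N) → ℂ :=
  𝓕⁻ (fun ξ : EuclideanSpace ℝ (Fin N) => (((2 * Real.pi * ‖ξ‖) ^ (2 * s) : ℝ) : ℂ) * 𝓕 f ξ)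

/-- `|∇^k f|(x)`: the Euclidean norm of the family of the `N^k` partial derivatives
`∂^k f / ∂x_{i_1} … ∂x_{i_k}` at `x`. -/
def gradNorm {N : ℕ} (k : ℕ) (f : EuclideanSpace ℝ (Fin N) → ℂ)
    (x : EuclideanSpace ℝ (Fin N)) : ℝ :=
  Real.sqrt (∑ i : Fin k → Fin N,
    ‖iteratedFDeriv ℝ k f x (fun j => EuclideanSpace.single (i j) (1 : ℝ))‖ ^ 2)

/-- The normalization constant `γ(α) = π^(N/2) 2^α Γ(α/2) / Γ((N-α)/2)` of the Riesz potential of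
order `α ∈ (0, N)` on `ℝ^N`. -/
def rieszGamma (N : ℕ) (α : ℝ) : ℝ :=
  Real.pi ^ ((N : ℝ) / 2) * 2 ^ α * Real.Gamma (α / 2) / Real.Gamma (((N : ℝ) - α) / 2)

/-- The falling factorial `(ν)_k = ν (ν - 1) ⋯ (ν - k + 1)`. -/
def fallingFactorial (ν : ℝ) (k : ℕ) : ℝ := ∏ j ∈ Finset.range k, (ν - j)

/-- The generalized binomial coefficient `ν (ν - 1) ⋯ (ν - n + 1) / n!`. -/
def realBinom (ν : ℝ) (n : ℕ) : ℝ := fallingFactorial ν n / (n.factorial : ℝ)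

/-- The constant `λ_N^{s,m}`, that is, the value of `|∇^m |x|^s|²` at the points with `|x| = 1`,
in its explicit form. (In the exponent, `m ≤ 2 n`, since `⌈m/2⌉ = (m + 1) / 2 ≤ n`.) -/
def lambdaConst (N : ℕ) (s : ℝ) (m : ℕ) : ℝ :=
  (m.factorial : ℝ) * ∑ l ∈ Finset.range (m / 2 + 1),
    ((m - 2 * l).factorial : ℝ) * (l.factorial : ℝ) *
      fallingFactorial (((N : ℝ) - 3) / 2 + l) l *
      (∑ n ∈ Finset.Icc ((m + 1) / 2) (m - l),
        (2 : ℝ) ^ (2 * n - m + l) * realBinom (s / 2) n * (n.choose (m - n) : ℝ) *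
          ((m - n).choose l : ℝ)) ^ 2

/-- `c_k = (λ_N^{k-N,k})^(-1/2) γ(N-k)^(-1)`. -/
def sharpConst (N k : ℕ) : ℝ :=
  (lambdaConst N ((k : ℝ) - N) k) ^ (-(1 / 2) : ℝ) * (rieszGamma N ((N : ℝ) - k))⁻¹

/-- `sup_{x ∈ ℝ^N} |u(x)|`, for a bounded function `u`. -/
def supAbs {N : ℕ} (u : EuclideanSpace ℝ (Fin N) → ℝ) : ℝ := ⨆ x, |u x|

/-- The function `x ↦ |∇^k (-Δ)^((N-k)/2) u(x)|` on `ℝ^N`, for a real-valued function `u`. -/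
def criticalDensity (N k : ℕ) (u : EuclideanSpace ℝ (Fin N) → ℝ) :
    EuclideanSpace ℝ (Fin N) → ℝ :=
  gradNorm k (fracLaplacian (((N : ℝ) - k) / 2) (fun x => (u x : ℂ)))

end

/-! The proof is a duality argument with the field V = |x|^N ∇^k |x|^(k-N). Since |∇^k |x|^(k-N)| =
√λ |x|^(-N) with λ = λ_N^{k-N,k}, V has constant length √λ away from the origin.

Two identities give u(0) in terms of V. The first is ∫ ⟨V, ∇^k f⟩ = λ ∫ |x|^(-k) f
(`integral_gradPair_eq`). The second is the Riesz representation ∫ |x|^(-k) (-Δ)^((N-k)/2) u =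
γ(N-k) u(0) (`IsTest.integral_riesz`). With f = (-Δ)^((N-k)/2) u they combine to ∫ ⟨V, ∇^k f⟩ = λ γ
u(0). Cauchy–Schwarz then bounds λ γ |u(0)| by √λ ∫ |∇^k f|, and a translation moves the origin to
any point.

The value of λ enters through the Bochner identity Δ⟨∇^k p, ∇^k f⟩ = 2⟨∇^(k+1) p, ∇^(k+1) f⟩ + ⟨∇^k
Δp, ∇^k f⟩ + ⟨∇^k p, ∇^k Δf⟩. Applied to powers of |x|, it yields a recursion in k for the polarized
constant. The explicit sum satisfies that recursion (`two_mul_lambdaBilin_succ`), which gives both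
the pointwise formula `gradPair_normPow` and the integrated formula `integral_normPow_gradPair`.

The duality needs (-Δ)^((N-k)/2) u and its derivatives to be integrable. For N - k odd the symbol is
not smooth at 0; integer powers of -Δ are split off and (-Δ)^(1/2) is written as a singular integral
of second differences (`IsTest.integrable_halfLaplacian`).

For N - k = 2m the operator is local, and (-Δ)^m(-log|x|) is a multiple of |x|^(k-N), for which
Cauchy–Schwarz against V is an equality. Truncating -log|x| at scales 1/c and 1 gives u(0) = log c,
while the truncation zones contribute O(1) to the integral; letting c → ∞ shows optimality
(`integral_tensorNorm_truncLog_le`). -/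

/-! ### The constant λ, polarized in the exponent, and its recursion in m. -/

theorem fallingFactorial_zero (ν : ℝ) : fallingFactorial ν 0 = 1 := by
  simp [fallingFactorial]

theorem fallingFactorial_succ (ν : ℝ) (k : ℕ) :
    fallingFactorial ν (k + 1) = fallingFactorial ν k * (ν - k) := by
  simp [fallingFactorial, Finset.prod_range_succ]

theorem fallingFactorial_succ_left (ν : ℝ) (k : ℕ) :
    fallingFactorial ν (k + 1) = ν * fallingFactorial (ν - 1) k := by
  rw [fallingFactorial, Finset.prod_range_succ', fallingFactorial, mul_comm]
  congr 1
  · simp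
  · refine Finset.prod_congr rfl fun i _ => ?_
    push_cast
    ring

theorem fallingFactorial_add (ν : ℝ) (j k : ℕ) :
    fallingFactorial ν (j + k) = fallingFactorial ν j * fallingFactorial (ν - j) k := by
  induction k with
  | zero => simp [fallingFactorial_zero]
  | succ k ih =>
    rw [← add_assoc, fallingFactorial_succ, ih, fallingFactorial_succ]
    push_cast
    ring

/-- Absorbing the factor a + l + 1 raises l by one; this is how the dimension enters the recursion.
-/
theorem fallingFactorial_shift_succ (a : ℝ) (l : ℕ) :
    fallingFactorial (a + (l + 1 : ℕ)) (l + 1) = (a + l + 1) * fallingFactorial (a + l) l := by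
  rw [fallingFactorial_succ_left]
  push_cast
  ring_nf

/-- The product `s (s - 2) ⋯ (s - 2l + 2)`. -/
noncomputable def evenFalling (s : ℝ) (l : ℕ) : ℝ := ∏ i ∈ Finset.range l, (s - 2 * i)

theorem evenFalling_succ (s : ℝ) (l : ℕ) :
    evenFalling s (l + 1) = evenFalling s l * (s - 2 * l) := by
  simp [evenFalling, Finset.prod_range_succ]

theorem evenFalling_succ_left (s : ℝ) (l : ℕ) :
    evenFalling s (l + 1) = s * evenFalling (s - 2) l := by
  rw [evenFalling, Finset.prod_range_succ', evenFalling, mul_comm]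
  congr 1
  · simp
  · refine Finset.prod_congr rfl fun i _ => ?_
    push_cast
    ring

theorem evenFalling_eq (s : ℝ) (l : ℕ) :
    evenFalling s l = 2 ^ l * fallingFactorial (s / 2) l := by
  induction l with
  | zero => simp [evenFalling, fallingFactorial_zero]
  | succ l ih =>
    rw [evenFalling_succ, ih, fallingFactorial_succ, pow_succ]
    ring

/-- The coefficient of `t^(m-2l) |y|^(2l)` in the Taylor expansion of `|e + t e + y|^s` at a unit
vector `e`, up to a combinatorial factor. -/
noncomputable def radialCoeff (l m : ℕ) (s : ℝ) : ℝ :=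
  evenFalling s l * fallingFactorial (s - 2 * l) (m - 2 * l)

/-- The combinatorial weight `m! / (l! (m - 2l)!)`, set to zero for `2 l > m`. -/
noncomputable def radialWeight (m l : ℕ) : ℝ :=
  if 2 * l ≤ m then (m.factorial : ℝ) / (l.factorial * (m - 2 * l).factorial) else 0

/-- The bilinear version of `λ_N^{s,m}`: with `a = (N - 3) / 2`, the constant `B` such that
`⟨∇^m |x|^s, ∇^m |x|^t⟩ = B |x|^(s+t-2m)`. -/
noncomputable def lambdaBilin (a : ℝ) (m : ℕ) (s t : ℝ) : ℝ :=
  ∑ l ∈ Finset.range (m / 2 + 1), radialWeight m l *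
    (fallingFactorial (a + l) l * (radialCoeff l m s * radialCoeff l m t))

theorem lambdaBilin_eq_sum_range (a : ℝ) (m : ℕ) (s t : ℝ) (n : ℕ) (hn : m / 2 < n) :
    lambdaBilin a m s t = ∑ l ∈ Finset.range n, radialWeight m l *
      (fallingFactorial (a + l) l * (radialCoeff l m s * radialCoeff l m t)) := by
  refine Finset.sum_subset (Finset.range_subset_range.2 hn) fun l _ hl => ?_
  rw [Finset.mem_range, not_lt] at hl
  rw [radialWeight, if_neg (by omega), zero_mul]

theorem lambdaBilin_zero (a s t : ℝ) : lambdaBilin a 0 s t = 1 := by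
  simp [lambdaBilin, radialWeight, radialCoeff, evenFalling, fallingFactorial_zero]

theorem radialCoeff_succ (l r : ℕ) (s : ℝ) :
    radialCoeff l (2 * l + r + 1) s = radialCoeff l (2 * l + r) s * (s - (2 * l + r : ℕ)) := by
  simp only [radialCoeff, show 2 * l + r + 1 - 2 * l = r + 1 by omega,
    show 2 * l + r - 2 * l = r by omega, fallingFactorial_succ]
  push_cast
  ring

theorem radialCoeff_pred (l r : ℕ) (s : ℝ) :
    radialCoeff l (2 * (l + 1) + r) s =
      radialCoeff (l + 1) (2 * (l + 1) + r) s * (s - 2 * l - 1) := by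
  simp only [radialCoeff, show 2 * (l + 1) + r - 2 * l = r + 1 + 1 by omega,
    show 2 * (l + 1) + r - 2 * (l + 1) = r by omega, evenFalling_succ, fallingFactorial_succ_left]
  push_cast
  ring_nf

/-- Lowering s by 2 shifts both products; the factors s - 2l and s - 2l - 1 fill the gap, so that a
falling factorial of length r becomes one of length r + 2 started at s - 2l. -/
theorem mul_radialCoeff_sub_two (l r : ℕ) (s : ℝ) :
    s * radialCoeff l (2 * l + r) (s - 2) * (s - 2 * l - 1) =
      radialCoeff l (2 * l + r) s * (s - (2 * l + r : ℕ)) * (s - (2 * l + r : ℕ) - 1) := by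
  have h : evenFalling s l * fallingFactorial (s - 2 * l) (r + 2) =
      evenFalling s (l + 1) * (s - 2 * l - 1) * fallingFactorial (s - 2 - 2 * l) r := by
    rw [evenFalling_succ, fallingFactorial_succ_left, fallingFactorial_succ_left]
    ring_nf
  rw [fallingFactorial_succ, fallingFactorial_succ, evenFalling_succ_left] at h
  simp only [radialCoeff, show 2 * l + r - 2 * l = r by omega]
  push_cast at h ⊢
  linear_combination -h

theorem mul_radialCoeff_pred_sub_two (l r : ℕ) (s : ℝ) :
    s * radialCoeff l (2 * (l + 1) + r) (s - 2) =
      radialCoeff (l + 1) (2 * (l + 1) + r) s * (s - (2 * (l + 1) + r : ℕ)) *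
        (s - (2 * (l + 1) + r : ℕ) - 1) := by
  simp only [radialCoeff, show 2 * (l + 1) + r - 2 * l = r + 1 + 1 by omega,
    show 2 * (l + 1) + r - 2 * (l + 1) = r by omega]
  rw [← mul_assoc, ← evenFalling_succ_left, fallingFactorial_succ, fallingFactorial_succ]
  push_cast
  ring_nf

theorem radialWeight_add (l r : ℕ) : radialWeight (2 * l + r) l =
    ((2 * l + r).factorial : ℝ) / (l.factorial * r.factorial) := by
  rw [radialWeight, if_pos (by omega), show 2 * l + r - 2 * l = r by omega]

theorem radialWeight_eq_zero {m l : ℕ} (h : m < 2 * l) : radialWeight m l = 0 :=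
  if_neg (by omega)

/-- The `l`-diagonal part of the recursion for `lambdaBilin`. -/
noncomputable def recDiag (m l : ℕ) (s t : ℝ) : ℝ :=
  (s + t - 2 * m) * (s + t - 2 * m - 2 * l - 1) * (radialCoeff l m s * radialCoeff l m t)
    - (s - 2 * l - 1) * (s * radialCoeff l m (s - 2)) * radialCoeff l m t
    - (t - 2 * l - 1) * (t * radialCoeff l m (t - 2)) * radialCoeff l m s

/-- The part of the recursion for `lambdaBilin` which raises `l`. -/
noncomputable def recShift (m l : ℕ) (s t : ℝ) : ℝ :=
  (s + t - 2 * m) * (radialCoeff l m s * radialCoeff l m t)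
    - s * radialCoeff l m (s - 2) * radialCoeff l m t
    - t * radialCoeff l m (t - 2) * radialCoeff l m s

theorem recDiag_add (l r : ℕ) (s t : ℝ) :
    recDiag (2 * l + r) l s t = radialCoeff l (2 * l + r) s * radialCoeff l (2 * l + r) t *
      (2 * (s - (2 * l + r : ℕ)) * (t - (2 * l + r : ℕ))
        - 2 * l * (s + t - 2 * (2 * l + r : ℕ))) := by
  have h₁ := mul_radialCoeff_sub_two l r s
  have h₂ := mul_radialCoeff_sub_two l r t
  rw [recDiag]
  linear_combination (-radialCoeff l (2 * l + r) t) * h₁ - radialCoeff l (2 * l + r) s * h₂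

theorem recShift_add (l r : ℕ) (s t : ℝ) :
    recShift (2 * (l + 1) + r) l s t = radialCoeff (l + 1) (2 * (l + 1) + r) s *
      radialCoeff (l + 1) (2 * (l + 1) + r) t *
      ((r + 2) * (2 * (s - (2 * (l + 1) + r : ℕ)) * (t - (2 * (l + 1) + r : ℕ))
        + (r + 1) * (s + t - 2 * (2 * (l + 1) + r : ℕ)))) := by
  rw [recShift, mul_radialCoeff_pred_sub_two l r s, mul_radialCoeff_pred_sub_two l r t,
    radialCoeff_pred l r s, radialCoeff_pred l r t]
  push_cast
  ring

theorem two_mul_weight_succ_zero (m : ℕ) (s t : ℝ) :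
    2 * (radialWeight (m + 1) 0 * (radialCoeff 0 (m + 1) s * radialCoeff 0 (m + 1) t)) =
      radialWeight m 0 * recDiag m 0 s t := by
  have h := recDiag_add 0 m s t
  have h₁ := radialCoeff_succ 0 m s
  have h₂ := radialCoeff_succ 0 m t
  have w₁ := radialWeight_add 0 m
  have w₂ := radialWeight_add 0 (m + 1)
  simp only [mul_zero, zero_add] at h h₁ h₂ w₁ w₂
  rw [h, h₁, h₂, w₁, w₂]
  have : (m.factorial : ℝ) ≠ 0 := by positivity
  have : ((m + 1).factorial : ℝ) ≠ 0 := by positivity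
  field_simp
  push_cast
  ring

/-- The recursion for `lambdaBilin`, compared coefficient by coefficient in the products
`fallingFactorial (a + l) l`: index l + 1 receives its own diagonal part and the shifted part of
index l. -/
theorem two_mul_weight_succ_succ (m l : ℕ) (s t : ℝ) :
    2 * (radialWeight (m + 1) (l + 1) *
      (radialCoeff (l + 1) (m + 1) s * radialCoeff (l + 1) (m + 1) t)) =
      radialWeight m (l + 1) * recDiag m (l + 1) s t + 2 * (radialWeight m l * recShift m l s t) := by
  rcases lt_or_ge m (2 * (l + 1)) with h | h
  · rw [radialWeight_eq_zero h]
    rcases lt_or_ge m (2 * l) with h' | h'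
    · rw [radialWeight_eq_zero h', radialWeight_eq_zero (by omega : m + 1 < 2 * (l + 1))]
      ring
    -- The two boundary cases: the diagonal weight at l + 1 already vanishes but the shifted one at
    -- l does not, and `recShift_add` requires m ≥ 2(l + 1).
    obtain rfl | rfl : m = 2 * l ∨ m = 2 * l + 1 := by omega
    · rw [radialWeight_eq_zero (by omega : 2 * l + 1 < 2 * (l + 1))]
      simp only [recShift, radialCoeff, tsub_self, fallingFactorial_zero, mul_one]
      rw [← evenFalling_succ_left, ← evenFalling_succ_left, evenFalling_succ, evenFalling_succ]
      push_cast
      ring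
    · have w₁ := radialWeight_add (l + 1) 0
      rw [show 2 * (l + 1) + 0 = 2 * l + 1 + 1 by ring] at w₁
      rw [w₁, radialWeight_add l 1]
      simp only [recShift, radialCoeff, show 2 * l + 1 + 1 - 2 * (l + 1) = 0 by omega,
        show 2 * l + 1 - 2 * l = 1 by omega, fallingFactorial_zero, fallingFactorial_succ, mul_one]
      rw [← mul_assoc s, ← mul_assoc t, ← evenFalling_succ_left, ← evenFalling_succ_left,
        evenFalling_succ, evenFalling_succ, Nat.factorial_succ, Nat.factorial_succ]
      have : (l.factorial : ℝ) ≠ 0 := by positivity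
      have : ((2 * l).factorial : ℝ) ≠ 0 := by positivity
      simp only [Nat.factorial_succ, Nat.factorial_zero]
      push_cast
      field_simp
      ring
  · obtain ⟨r, rfl⟩ := Nat.exists_eq_add_of_le h
    have w₁ := radialWeight_add (l + 1) (r + 1)
    have w₂ := radialWeight_add l (r + 2)
    rw [← add_assoc] at w₁
    rw [show 2 * l + (r + 2) = 2 * (l + 1) + r by ring] at w₂
    rw [recDiag_add, recShift_add, radialCoeff_succ, radialCoeff_succ, w₁, w₂, radialWeight_add]
    simp only [Nat.factorial_succ]
    have : (l.factorial : ℝ) ≠ 0 := by positivity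
    have : (r.factorial : ℝ) ≠ 0 := by positivity
    push_cast
    field_simp
    ring

/-- The Bochner identity for |x|^s and |x|^t read on coefficients, with 2a + 1 = N - 2 and Δ|x|^s =
s(s + N - 2)|x|^(s-2). Writing 2a + 1 = 2(a + l + 1) - (2l + 1) in the l-th term splits it into
`recDiag`, which keeps l, and `recShift`, whose factor a + l + 1 moves it to l + 1. -/
theorem two_mul_lambdaBilin_succ (a : ℝ) (m : ℕ) (s t : ℝ) :
    2 * lambdaBilin a (m + 1) s t =
      (s + t - 2 * m) * (s + t - 2 * m + (2 * a + 1)) * lambdaBilin a m s t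
      - s * (s + (2 * a + 1)) * lambdaBilin a m (s - 2) t
      - t * (t + (2 * a + 1)) * lambdaBilin a m s (t - 2) := by
  have hsplit : (s + t - 2 * m) * (s + t - 2 * m + (2 * a + 1)) * lambdaBilin a m s t
      - s * (s + (2 * a + 1)) * lambdaBilin a m (s - 2) t
      - t * (t + (2 * a + 1)) * lambdaBilin a m s (t - 2) =
      ∑ l ∈ Finset.range (m + 2), radialWeight m l * recDiag m l s t * fallingFactorial (a + l) l
      + ∑ l ∈ Finset.range (m + 1), 2 * (radialWeight m l * recShift m l s t) *
        fallingFactorial (a + (l + 1 : ℕ)) (l + 1) := by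
    rw [Finset.sum_range_succ, radialWeight_eq_zero (by omega : m < 2 * (m + 1)),
      lambdaBilin_eq_sum_range a m s t (m + 1) (by omega),
      lambdaBilin_eq_sum_range a m (s - 2) t (m + 1) (by omega),
      lambdaBilin_eq_sum_range a m s (t - 2) (m + 1) (by omega), zero_mul, zero_mul, add_zero,
      ← Finset.sum_add_distrib, Finset.mul_sum, Finset.mul_sum, Finset.mul_sum,
      ← Finset.sum_sub_distrib, ← Finset.sum_sub_distrib]
    refine Finset.sum_congr rfl fun l _ => ?_
    rw [fallingFactorial_shift_succ, recDiag, recShift]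
    ring
  rw [hsplit, lambdaBilin_eq_sum_range a (m + 1) s t (m + 2) (by omega),
    Finset.sum_range_succ' _ (m + 1), Finset.sum_range_succ' _ (m + 1), mul_add, Finset.mul_sum, add_right_comm, ← Finset.sum_add_distrib]
  congr 1
  · refine Finset.sum_congr rfl fun l _ => ?_
    have h := two_mul_weight_succ_succ m l s t
    linear_combination fallingFactorial (a + (l + 1 : ℕ)) (l + 1) * h
  · have h := two_mul_weight_succ_zero m s t
    linear_combination fallingFactorial (a + (0 : ℕ)) 0 * h

/-! ### Comparison with the explicit formula for λ, and positivity. -/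

/-- The coefficient of t^M in (1 + 2t + t²)^μ = (1 + t)^(2μ), multiplied by M!. -/
theorem sum_trinomial (μ : ℝ) (M n : ℕ) (hn : M / 2 < n) :
    (M.factorial : ℝ) * ∑ j ∈ Finset.range n, (if 2 * j ≤ M then 2 ^ (M - 2 * j) *
      fallingFactorial μ (M - j) / ((M - 2 * j).factorial * j.factorial) else 0) =
      fallingFactorial (2 * μ) M := by
  set f : ℕ → ℕ → ℝ := fun M j => if 2 * j ≤ M then 2 ^ (M - 2 * j) *
      fallingFactorial μ (M - j) / ((M - 2 * j).factorial * j.factorial) else 0 with hf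
  have hbig : ∀ M j, M < 2 * j → f M j = 0 := fun M j h => if_neg (by omega)
  have hadd : ∀ j r, f (2 * j + r) j =
      2 ^ r * fallingFactorial μ (j + r) / (r.factorial * j.factorial) := by
    intro j r
    simp only [hf]
    rw [if_pos (by omega), show 2 * j + r - 2 * j = r by omega, show 2 * j + r - j = j + r by omega]
  have hone : ∀ M j, 2 * (μ - (M - j)) * f M j = (M + 1 - 2 * j) * f (M + 1) j := by
    intro M j
    rcases lt_or_ge M (2 * j) with h | h
    · rw [hbig M j h]
      rcases eq_or_ne (M + 1) (2 * j) with h' | h'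
      · have : ((M : ℝ) + 1) = 2 * j := by exact_mod_cast h'
        rw [this]; ring
      · rw [hbig (M + 1) j (by omega)]; ring
    · obtain ⟨r, rfl⟩ := Nat.exists_eq_add_of_le h
      rw [add_assoc, hadd, hadd, ← add_assoc, fallingFactorial_succ, pow_succ, Nat.factorial_succ]
      have : (j.factorial : ℝ) ≠ 0 := by positivity
      have : (r.factorial : ℝ) ≠ 0 := by positivity
      push_cast
      field_simp
      ring
  have htwo : ∀ M j, (M - 2 * j) * f M j = 2 * (j + 1) * f (M + 1) (j + 1) := by
    intro M j
    rcases lt_or_ge M (2 * j + 1) with h | h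
    · rw [hbig (M + 1) (j + 1) (by omega)]
      rcases eq_or_ne M (2 * j) with h' | h'
      · rw [h']; push_cast; ring
      · rw [hbig M j (by omega)]; ring
    · obtain ⟨r, rfl⟩ := Nat.exists_eq_add_of_le h
      rw [show 2 * j + 1 + r + 1 = 2 * (j + 1) + r by ring, hadd,
        show 2 * j + 1 + r = 2 * j + (r + 1) by ring, hadd, Nat.factorial_succ, Nat.factorial_succ,
        show j + 1 + r = j + (r + 1) by ring]
      have : (j.factorial : ℝ) ≠ 0 := by positivity
      have : (r.factorial : ℝ) ≠ 0 := by positivity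
      push_cast
      field_simp
      ring
  have hind : ∀ M, ∀ n, M / 2 < n →
      (M.factorial : ℝ) * ∑ j ∈ Finset.range n, f M j = fallingFactorial (2 * μ) M := by
    have hlarge : ∀ M n, M / 2 < n → ∑ j ∈ Finset.range n, f M j =
        ∑ j ∈ Finset.range (M / 2 + 1), f M j := by
      intro M n h
      refine (Finset.sum_subset (Finset.range_subset_range.2 h) fun l _ hl => ?_).symm
      rw [Finset.mem_range, not_lt] at hl
      exact hbig _ _ (by omega)
    intro M
    induction M with
    | zero =>
      intro n h
      rw [hlarge 0 n h]
      simp [hf, fallingFactorial_zero]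
    | succ M ih =>
      intro n h
      have key : ((M : ℝ) + 1) * ∑ j ∈ Finset.range (M + 2), f (M + 1) j =
          (2 * μ - M) * ∑ j ∈ Finset.range (M + 1), f M j := by
        -- Split 2μ - M = 2(μ - M + j) + (M - 2j): the first part keeps j and the second raises it,
        -- and on the right the weights (M + 1 - 2j) and 2j add up to M + 1.
        have e₁ : (2 * μ - M) * ∑ j ∈ Finset.range (M + 1), f M j =
            ∑ j ∈ Finset.range (M + 1), (M + 1 - 2 * j) * f (M + 1) j +
            ∑ j ∈ Finset.range (M + 1), 2 * ((j + 1 : ℕ) : ℝ) * f (M + 1) (j + 1) := by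
          rw [Finset.mul_sum, ← Finset.sum_add_distrib]
          refine Finset.sum_congr rfl fun j _ => ?_
          push_cast
          rw [← hone, ← htwo]
          ring
        have e₂ : ∑ j ∈ Finset.range (M + 1), ((M : ℝ) + 1 - 2 * j) * f (M + 1) j =
            ∑ j ∈ Finset.range (M + 2), ((M : ℝ) + 1 - 2 * j) * f (M + 1) j := by
          rw [Finset.sum_range_succ _ (M + 1), hbig (M + 1) (M + 1) (by omega)]
          ring
        have e₃ : ∑ j ∈ Finset.range (M + 1), 2 * ((j + 1 : ℕ) : ℝ) * f (M + 1) (j + 1) =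
            ∑ j ∈ Finset.range (M + 2), 2 * (j : ℝ) * f (M + 1) j := by
          rw [Finset.sum_range_succ' _ (M + 1)]
          simp
        rw [e₁, e₂, e₃, ← Finset.sum_add_distrib, Finset.mul_sum]
        refine Finset.sum_congr rfl fun j _ => ?_
        ring
      rw [hlarge (M + 1) n h, ← hlarge (M + 1) (M + 2) (by omega), fallingFactorial_succ,
        ← ih (M + 1) (by omega), Nat.factorial_succ]
      push_cast
      linear_combination (M.factorial : ℝ) * key
  exact hind M n hn

/-- With m = 2l + M and n = l + M - j, the factor (s/2)_l splits off from (s/2)_n, and the remaining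
sum is the trinomial one with μ = s/2 - l. -/
theorem lambdaConst_inner_sum (s : ℝ) (m l : ℕ) (hl : 2 * l ≤ m) :
    ∑ n ∈ Finset.Icc ((m + 1) / 2) (m - l),
        (2 : ℝ) ^ (2 * n - m + l) * realBinom (s / 2) n * (n.choose (m - n) : ℝ) *
          ((m - n).choose l : ℝ) =
      radialCoeff l m s / (l.factorial * (m - 2 * l).factorial) := by
  obtain ⟨M, rfl⟩ := Nat.exists_eq_add_of_le hl
  have h := sum_trinomial (s / 2 - l) M (M / 2 + 1) (by omega)
  rw [radialCoeff, evenFalling_eq, show 2 * l + M - 2 * l = M by omega,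
    show s - 2 * l = 2 * (s / 2 - l) by ring, ← h]
  have hre : ∑ n ∈ Finset.Icc ((2 * l + M + 1) / 2) (2 * l + M - l),
      (2 : ℝ) ^ (2 * n - (2 * l + M) + l) * realBinom (s / 2) n *
        (n.choose (2 * l + M - n) : ℝ) * ((2 * l + M - n).choose l : ℝ) =
      ∑ j ∈ Finset.range (M / 2 + 1), (2 : ℝ) ^ (M - 2 * j + l) * realBinom (s / 2) (l + M - j) *
        ((l + M - j).choose (l + j) : ℝ) * ((l + j).choose l : ℝ) := by
    refine Finset.sum_nbij' (fun n => l + M - n) (fun j => l + M - j) ?_ ?_ ?_ ?_ ?_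
    · intro n hn; simp only [Finset.mem_Icc, Finset.mem_range] at *; omega
    · intro n hn; simp only [Finset.mem_Icc, Finset.mem_range] at *; omega
    · intro n hn; simp only [Finset.mem_Icc] at *; omega
    · intro n hn; simp only [Finset.mem_range] at *; omega
    · intro n hn
      simp only [Finset.mem_Icc] at hn
      rw [show M - 2 * (l + M - n) = 2 * n - (2 * l + M) by omega,
        show l + M - (l + M - n) = n by omega, show l + (l + M - n) = 2 * l + M - n by omega]
  rw [hre, Finset.mul_sum, Finset.mul_sum, Finset.sum_div]
  refine Finset.sum_congr rfl fun j hj => ?_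
  rw [Finset.mem_range] at hj
  rw [if_pos (by omega)]
  obtain ⟨r, rfl⟩ := Nat.exists_eq_add_of_le (show 2 * j ≤ M by omega)
  rw [show l + (2 * j + r) - j = l + (j + r) by omega, show 2 * j + r - 2 * j = r by omega,
    show 2 * j + r - j = j + r by omega, realBinom, fallingFactorial_add,
    Nat.cast_choose ℝ (show l + j ≤ l + (j + r) by omega),
    Nat.cast_choose ℝ (show l ≤ l + j by omega), show l + (j + r) - (l + j) = r by omega,
    show l + j - l = j by omega, pow_add]
  have : (l.factorial : ℝ) ≠ 0 := by positivity
  have : (r.factorial : ℝ) ≠ 0 := by positivity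
  have : (j.factorial : ℝ) ≠ 0 := by positivity
  have : ((l + j).factorial : ℝ) ≠ 0 := by positivity
  have : ((l + (j + r)).factorial : ℝ) ≠ 0 := by positivity
  field_simp

theorem lambdaConst_eq (N : ℕ) (s : ℝ) (m : ℕ) :
    lambdaConst N s m = lambdaBilin (((N : ℝ) - 3) / 2) m s s := by
  rw [lambdaConst, lambdaBilin, Finset.mul_sum]
  refine Finset.sum_congr rfl fun l hl => ?_
  rw [Finset.mem_range] at hl
  rw [lambdaConst_inner_sum s m l (by omega), radialWeight, if_pos (by omega)]
  have : (l.factorial : ℝ) ≠ 0 := by positivity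
  have : ((m - 2 * l).factorial : ℝ) ≠ 0 := by positivity
  field_simp

theorem fallingFactorial_shift_nonneg {a : ℝ} (ha : -1 < a) (l : ℕ) :
    0 ≤ fallingFactorial (a + l) l := by
  refine Finset.prod_nonneg fun j hj => ?_
  have : (j : ℝ) + 1 ≤ l := by exact_mod_cast Finset.mem_range.1 hj
  linarith

/-- All terms are nonnegative because (N - 3)/2 > -1, and the term l = 0 is the square of a product
of the negative numbers k - N - j, up to a positive weight. -/
theorem lambdaConst_pos (N k : ℕ) (hk : 1 ≤ k) (hkN : k < N) :
    0 < lambdaConst N ((k : ℝ) - N) k := by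
  have hN : (2 : ℝ) ≤ N := by exact_mod_cast (by omega : 2 ≤ N)
  have hs : (k : ℝ) - N < 0 := sub_neg.2 (by exact_mod_cast hkN)
  rw [lambdaConst_eq, lambdaBilin, Finset.sum_range_succ']
  refine add_pos_of_nonneg_of_pos (Finset.sum_nonneg fun l _ => ?_) ?_
  · refine mul_nonneg ?_ (mul_nonneg (fallingFactorial_shift_nonneg (by linarith) _)
      (mul_self_nonneg _))
    rw [radialWeight]
    positivity
  · have h : radialCoeff 0 k ((k : ℝ) - N) ≠ 0 := by
      simp only [radialCoeff, evenFalling, Finset.range_zero, Finset.prod_empty, one_mul]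
      refine Finset.prod_ne_zero_iff.2 fun j _ => ?_
      have : (0 : ℝ) ≤ j := j.cast_nonneg
      push_cast
      linarith
    rw [fallingFactorial_zero, one_mul, radialWeight, if_pos (by omega)]
    have := mul_self_pos.2 h
    positivity

/-! ### Partial derivatives, the Bochner identity and powers of |x| on the punctured space. -/

section PuncturedCalculus

open Set

/-- Euclidean space `ℝ^N`. -/
abbrev Euc (N : ℕ) := EuclideanSpace ℝ (Fin N)

variable {N : ℕ} {F : Type*} [NormedAddCommGroup F] [NormedSpace ℝ F]

/-- The `a`-th partial derivative. -/
noncomputable def partialD (a : Fin N) (f : Euc N → F) : Euc N → F :=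
  fun x => fderiv ℝ f x (EuclideanSpace.single a 1)

/-- The Laplacian, as the sum of the second partial derivatives. -/
noncomputable def lapl (f : Euc N → F) : Euc N → F := fun x => ∑ a, partialD a (partialD a f) x

/-- The contraction `∑ ∂_{i_1} … ∂_{i_k} f • ∂_{i_1} … ∂_{i_k} g` of the `k`-th derivatives of `f`
and `g`. -/
noncomputable def gradPair : ℕ → (Euc N → ℝ) → (Euc N → F) → Euc N → F
  | 0, f, g => fun x => f x • g x
  | k + 1, f, g => fun x => ∑ a, gradPair k (partialD a f) (partialD a g) x

variable {U : Set (Euc N)} {f g : Euc N → F} {p q : Euc N → ℝ}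

theorem partialD_congr (hU : IsOpen U) (h : EqOn f g U) (a : Fin N) :
    EqOn (partialD a f) (partialD a g) U := by
  intro x hx
  have : f =ᶠ[nhds x] g := Filter.eventuallyEq_of_mem (hU.mem_nhds hx) h
  simp only [partialD, this.fderiv_eq]

theorem lapl_congr (hU : IsOpen U) (h : EqOn f g U) : EqOn (lapl f) (lapl g) U := fun _ hx =>
  Finset.sum_congr rfl fun a _ => partialD_congr hU (partialD_congr hU h a) a hx

theorem gradPair_congr (hU : IsOpen U) (k : ℕ) : ∀ {p q : Euc N → ℝ} {f g : Euc N → F},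
    EqOn p q U → EqOn f g U → EqOn (gradPair k p f) (gradPair k q g) U := by
  induction k with
  | zero => intro p q f g h h' x hx; simp only [gradPair, h hx, h' hx]
  | succ k ih =>
    intro p q f g h h' x hx
    exact Finset.sum_congr rfl fun a _ =>
      ih (partialD_congr hU h a) (partialD_congr hU h' a) hx

theorem ContDiffOn.differentiableAt_of_isOpen (hU : IsOpen U) (hf : ContDiffOn ℝ ∞ f U)
    {x : Euc N} (hx : x ∈ U) : DifferentiableAt ℝ f x :=
  (hf.contDiffAt (hU.mem_nhds hx)).differentiableAt (by simp)

theorem ContDiffOn.fderiv_infty (hU : IsOpen U) (hf : ContDiffOn ℝ ∞ f U) :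
    ContDiffOn ℝ ∞ (fderiv ℝ f) U :=
  hf.fderiv_of_isOpen hU (by simp)

theorem ContDiffOn.partialD (hU : IsOpen U) (hf : ContDiffOn ℝ ∞ f U) (a : Fin N) :
    ContDiffOn ℝ ∞ (partialD a f) U :=
  (hf.fderiv_infty hU).clm_apply contDiffOn_const

theorem ContDiff.partialD (hf : ContDiff ℝ ∞ f) (a : Fin N) : ContDiff ℝ ∞ (partialD a f) := by
  rw [← contDiffOn_univ] at hf ⊢
  exact ContDiffOn.partialD isOpen_univ hf a

theorem ContDiffOn.lapl (hU : IsOpen U) (hf : ContDiffOn ℝ ∞ f U) : ContDiffOn ℝ ∞ (lapl f) U :=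
  ContDiffOn.sum fun a _ => (hf.partialD hU a).partialD hU a

theorem ContDiff.lapl (hf : ContDiff ℝ ∞ f) : ContDiff ℝ ∞ (lapl f) :=
  ContDiff.sum fun a _ => (hf.partialD a).partialD a

theorem ContDiffOn.gradPair (hU : IsOpen U) (k : ℕ) : ∀ {p : Euc N → ℝ} {f : Euc N → F},
    ContDiffOn ℝ ∞ p U → ContDiffOn ℝ ∞ f U → ContDiffOn ℝ ∞ (gradPair k p f) U := by
  induction k with
  | zero => intro p f hp hf; exact hp.smul hf
  | succ k ih =>
    intro p f hp hf
    exact ContDiffOn.sum fun a _ => ih (hp.partialD hU a) (hf.partialD hU a)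

theorem partialD_smul (hU : IsOpen U) (hp : ContDiffOn ℝ ∞ p U) (hf : ContDiffOn ℝ ∞ f U)
    (a : Fin N) : EqOn (partialD a fun x => p x • f x)
      (fun x => partialD a p x • f x + p x • partialD a f x) U := by
  intro x hx
  simp only [partialD]
  rw [fderiv_fun_smul (hp.differentiableAt_of_isOpen hU hx) (hf.differentiableAt_of_isOpen hU hx)]
  simp [add_comm]

theorem partialD_add (hU : IsOpen U) (hf : ContDiffOn ℝ ∞ f U) (hg : ContDiffOn ℝ ∞ g U)
    (a : Fin N) : EqOn (partialD a fun x => f x + g x)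
      (fun x => partialD a f x + partialD a g x) U := by
  intro x hx
  simp only [partialD]
  rw [fderiv_fun_add (hf.differentiableAt_of_isOpen hU hx) (hg.differentiableAt_of_isOpen hU hx)]
  simp

theorem partialD_sum {ι : Type*} (u : Finset ι) {h : ι → Euc N → F} (hU : IsOpen U)
    (hh : ∀ i ∈ u, ContDiffOn ℝ ∞ (h i) U) (a : Fin N) :
    EqOn (partialD a fun x => ∑ i ∈ u, h i x) (fun x => ∑ i ∈ u, partialD a (h i) x) U := by
  intro x hx
  simp only [partialD]
  rw [fderiv_fun_sum fun i hi => (hh i hi).differentiableAt_of_isOpen hU hx]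
  simp

theorem partialD_const_smul (c : ℝ) (f : Euc N → F) (a : Fin N) :
    partialD a (fun x => c • f x) = fun x => c • partialD a f x := by
  ext x
  simp only [partialD]
  rw [show (fun x => c • f x) = c • f from rfl, fderiv_const_smul_field]
  simp

theorem partialD_comm (hU : IsOpen U) (hf : ContDiffOn ℝ ∞ f U) (a b : Fin N) :
    EqOn (partialD a (partialD b f)) (partialD b (partialD a f)) U := by
  have key : ∀ a b : Fin N, ∀ x ∈ U, partialD a (partialD b f) x =
      fderiv ℝ (fderiv ℝ f) x (EuclideanSpace.single a 1) (EuclideanSpace.single b 1) := by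
    intro a b x hx
    have hd := (hf.fderiv_infty hU).contDiffAt (hU.mem_nhds hx) |>.differentiableAt (by simp)
    rw [partialD, show partialD b f =
      ContinuousLinearMap.apply ℝ F (EuclideanSpace.single b (1 : ℝ)) ∘ fderiv ℝ f from rfl,
      fderiv_comp x (ContinuousLinearMap.differentiableAt _) hd, ContinuousLinearMap.fderiv]
    simp
  intro x hx
  rw [key a b x hx, key b a x hx]
  have hs : IsSymmSndFDerivAt ℝ f x :=
    (hf.contDiffAt (hU.mem_nhds hx)).isSymmSndFDerivAt (by
      rw [minSmoothness_of_isRCLikeNormedField]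
      exact WithTop.coe_le_coe.2 le_top)
  exact hs _ _

theorem lapl_sum {ι : Type*} (u : Finset ι) {h : ι → Euc N → F} (hU : IsOpen U)
    (hh : ∀ i ∈ u, ContDiffOn ℝ ∞ (h i) U) :
    EqOn (lapl fun x => ∑ i ∈ u, h i x) (fun x => ∑ i ∈ u, lapl (h i) x) U := by
  intro x hx
  simp only [lapl]
  rw [Finset.sum_comm]
  refine Finset.sum_congr rfl fun a _ => ?_
  rw [partialD_congr hU (partialD_sum u hU hh a) a hx]
  exact partialD_sum u hU (fun i hi => (hh i hi).partialD hU a) a hx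

theorem lapl_const_smul (c : ℝ) (f : Euc N → F) :
    lapl (fun x => c • f x) = fun x => c • lapl f x := by
  ext x
  simp only [lapl, partialD_const_smul, Finset.smul_sum]

theorem lapl_smul (hU : IsOpen U) (hp : ContDiffOn ℝ ∞ p U) (hf : ContDiffOn ℝ ∞ f U) :
    EqOn (lapl fun x => p x • f x) (fun x => (2 : ℝ) • gradPair 1 p f x + lapl p x • f x +
      p x • lapl f x) U := by
  intro x hx
  simp only [lapl, gradPair, Finset.smul_sum, Finset.sum_smul]
  rw [← Finset.sum_add_distrib, ← Finset.sum_add_distrib]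
  refine Finset.sum_congr rfl fun a _ => ?_
  have hp' := hp.partialD hU a
  have hf' := hf.partialD hU a
  have h := partialD_add hU (hp'.smul hf) (hp.smul hf') a hx
  simp only [Pi.smul_apply'] at h
  rw [partialD_congr hU (partialD_smul hU hp hf a) a hx, show partialD a _ x = _ from h]
  have h₁ := partialD_smul hU hp' hf a hx
  have h₂ := partialD_smul hU hp hf' a hx
  simp only at h₁ h₂
  rw [show partialD a (partialD a p • f) x = _ from h₁, show partialD a (p • partialD a f) x = _ from h₂,
    two_smul]
  abel

theorem lapl_partialD (hU : IsOpen U) (hf : ContDiffOn ℝ ∞ f U) (a : Fin N) :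
    EqOn (lapl (partialD a f)) (partialD a (lapl f)) U := by
  intro x hx
  have h := partialD_sum Finset.univ hU
    (fun b _ => (hf.partialD hU b).partialD hU b) a hx
  simp only [lapl] at h ⊢
  rw [show partialD a (lapl f) x = _ from h]
  refine Finset.sum_congr rfl fun b _ => ?_
  rw [partialD_congr hU (partialD_comm hU hf b a) b hx]
  exact partialD_comm hU (hf.partialD hU b) b a hx

/-- The polarized Bochner identity for the `k`-th derivatives. -/
theorem lapl_gradPair (hU : IsOpen U) (k : ℕ) : ∀ {p : Euc N → ℝ} {f : Euc N → F},
    ContDiffOn ℝ ∞ p U → ContDiffOn ℝ ∞ f U → EqOn (lapl (gradPair k p f))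
      (fun x => (2 : ℝ) • gradPair (k + 1) p f x + gradPair k (lapl p) f x +
        gradPair k p (lapl f) x) U := by
  induction k with
  | zero => intro p f hp hf; exact lapl_smul hU hp hf
  | succ k ih =>
    intro p f hp hf x hx
    have h := lapl_sum Finset.univ hU
      (fun a _ => ContDiffOn.gradPair hU k (hp.partialD hU a) (hf.partialD hU a)) hx
    rw [show lapl (gradPair (k + 1) p f) x = _ from h]
    simp only
    rw [gradPair, gradPair, gradPair, Finset.smul_sum, ← Finset.sum_add_distrib,
      ← Finset.sum_add_distrib]
    refine Finset.sum_congr rfl fun a _ => ?_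
    rw [ih (hp.partialD hU a) (hf.partialD hU a) hx]
    simp only
    rw [gradPair_congr hU k (lapl_partialD hU hp a) (fun _ _ => rfl) hx,
      gradPair_congr hU k (fun _ _ => rfl) (lapl_partialD hU hf a) hx]

theorem gradPair_const_smul_left (k : ℕ) (c : ℝ) : ∀ (p : Euc N → ℝ) (f : Euc N → F),
    gradPair k (fun x => c • p x) f = fun x => c • gradPair k p f x := by
  induction k with
  | zero => intro p f; ext x; simp [gradPair, mul_smul]
  | succ k ih => intro p f; ext x; simp only [gradPair, partialD_const_smul, ih, Finset.smul_sum]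

theorem gradPair_const_smul_right (k : ℕ) (c : ℝ) : ∀ (p : Euc N → ℝ) (f : Euc N → F),
    gradPair k p (fun x => c • f x) = fun x => c • gradPair k p f x := by
  induction k with
  | zero => intro p f; ext x; simp [gradPair, smul_comm c]
  | succ k ih => intro p f; ext x; simp only [gradPair, partialD_const_smul, ih, Finset.smul_sum]

/-- The last slot of the iterated derivative is the one differentiated first, which matches the
recursion defining `gradPair`. -/
theorem iteratedFDeriv_snoc (hU : IsOpen U) (hf : ContDiffOn ℝ ∞ f U) {x : Euc N} (hx : x ∈ U)
    (k : ℕ) (i : Fin k → Fin N) (a : Fin N) :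
    iteratedFDeriv ℝ (k + 1) f x
      (fun j => EuclideanSpace.single (Fin.snoc (α := fun _ => Fin N) i a j) (1 : ℝ)) =
      iteratedFDeriv ℝ k (partialD a f) x (fun j => EuclideanSpace.single (i j) (1 : ℝ)) := by
  rw [iteratedFDeriv_succ_apply_right]
  have h : partialD a f =
      ContinuousLinearMap.apply ℝ F (EuclideanSpace.single a (1 : ℝ)) ∘ fderiv ℝ f := rfl
  rw [h, ContinuousLinearMap.iteratedFDeriv_comp_left _
    (((hf.fderiv_infty hU).contDiffAt (hU.mem_nhds hx)).of_le (m := k) (by exact_mod_cast le_top))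
    le_rfl]
  simp [Fin.init_def]

theorem gradPair_eq_sum (hU : IsOpen U) (k : ℕ) : ∀ {p : Euc N → ℝ} {f : Euc N → F},
    ContDiffOn ℝ ∞ p U → ContDiffOn ℝ ∞ f U → ∀ x ∈ U, gradPair k p f x =
      ∑ i : Fin k → Fin N,
        iteratedFDeriv ℝ k p x (fun j => EuclideanSpace.single (i j) (1 : ℝ)) •
        iteratedFDeriv ℝ k f x (fun j => EuclideanSpace.single (i j) (1 : ℝ)) := by
  induction k with
  | zero => intro p f _ _ x _; simp [gradPair]
  | succ k ih =>
    intro p f hp hf x hx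
    rw [← (Fin.snocEquiv fun _ => Fin N).sum_comp, Fintype.sum_prod_type, gradPair]
    refine Finset.sum_congr rfl fun a _ => ?_
    rw [ih (hp.partialD hU a) (hf.partialD hU a) x hx]
    refine Finset.sum_congr rfl fun i _ => ?_
    rw [← iteratedFDeriv_snoc hU hp hx, ← iteratedFDeriv_snoc hU hf hx]
    rfl

/-! ### Powers of the norm -/

/-- The function `|x|^s`. -/
noncomputable def normPow (s : ℝ) : Euc N → ℝ := fun x => ‖x‖ ^ s

theorem isOpen_punctured : IsOpen ({0}ᶜ : Set (Euc N)) := isOpen_compl_singleton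

theorem contDiffOn_normPow (s : ℝ) : ContDiffOn ℝ ∞ (normPow s : Euc N → ℝ) {0}ᶜ := by
  intro x hx
  exact ((contDiffAt_norm ℝ hx).rpow_const_of_ne (norm_ne_zero_iff.2 hx)).contDiffWithinAt

theorem partialD_normPow (s : ℝ) (a : Fin N) :
    EqOn (partialD a (normPow s)) (fun x => (s * x a) • normPow (s - 2) x) {0}ᶜ := by
  intro x hx
  have hx0 : 0 < ‖x‖ := norm_pos_iff.2 hx
  have h2 : HasFDerivAt (fun y : Euc N => (‖y‖ ^ 2) ^ (s / 2))
      ((s / 2 * (‖x‖ ^ 2) ^ (s / 2 - 1)) • (2 • innerSL ℝ x)) x :=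
    (hasStrictFDerivAt_norm_sq x).hasFDerivAt.rpow_const (Or.inl (by positivity))
  have he : (normPow s : Euc N → ℝ) = fun y => (‖y‖ ^ 2) ^ (s / 2) := by
    ext y
    rw [normPow, ← Real.rpow_natCast, ← Real.rpow_mul (norm_nonneg _)]
    congr 1
    push_cast
    ring
  simp only [partialD]
  rw [he, h2.fderiv, normPow, ← Real.rpow_natCast, ← Real.rpow_mul (norm_nonneg _)]
  rw [show ((2 : ℕ) : ℝ) * (s / 2 - 1) = s - 2 by push_cast; ring]
  simp [EuclideanSpace.inner_single_right]
  ring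

theorem partialD_coord (a b : Fin N) (x : Euc N) :
    partialD a (fun y : Euc N => y b) x = if a = b then 1 else 0 := by
  have h : HasFDerivAt (fun y : Euc N => y b) (EuclideanSpace.proj b : Euc N →L[ℝ] ℝ) x :=
    (EuclideanSpace.proj b : Euc N →L[ℝ] ℝ).hasFDerivAt
  simp only [partialD]
  rw [h.fderiv]
  simp [eq_comm]

theorem sum_sq_mul_normPow (s : ℝ) {x : Euc N} (hx : x ≠ 0) :
    (∑ a, x a ^ 2) * normPow (s - 2) x = normPow s x := by
  have hx0 : 0 < ‖x‖ := norm_pos_iff.2 hx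
  rw [← EuclideanSpace.real_norm_sq_eq, normPow, normPow, ← Real.rpow_natCast,
    ← Real.rpow_add hx0]
  congr 1
  push_cast
  ring

theorem contDiff_coord (a : Fin N) : ContDiff ℝ ∞ (fun y : Euc N => y a) :=
  (EuclideanSpace.proj a : Euc N →L[ℝ] ℝ).contDiff

theorem lapl_normPow (s : ℝ) :
    EqOn (lapl (normPow s)) (fun x => (s * (s + N - 2)) • normPow (s - 2) x)
      ({0}ᶜ : Set (Euc N)) := by
  intro x hx
  have hc : ∀ a : Fin N, ContDiffOn ℝ ∞ (fun x : Euc N => s * x a) {0}ᶜ := fun a =>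
    (contDiff_const.mul (contDiff_coord a)).contDiffOn
  have hterm : ∀ a : Fin N, partialD a (partialD a (normPow s)) x =
      s * normPow (s - 2) x + s * (s - 2) * (x a ^ 2 * normPow (s - 2 - 2) x) := by
    intro a
    have h1 : partialD a (fun y : Euc N => s * y a) x = s := by
      have := congrFun (partialD_const_smul s (fun y : Euc N => y a) a) x
      simp only [smul_eq_mul, partialD_coord, if_true, mul_one] at this
      exact this
    rw [partialD_congr isOpen_punctured (partialD_normPow s a) a hx,
      partialD_smul isOpen_punctured (hc a) (contDiffOn_normPow _) a hx]
    simp only [smul_eq_mul]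
    rw [partialD_normPow (s - 2) a hx, h1]
    simp only [smul_eq_mul]
    ring
  simp only [lapl, hterm]
  rw [Finset.sum_add_distrib, ← Finset.mul_sum, ← Finset.mul_sum, ← Finset.sum_mul, sum_sq_mul_normPow _ hx]
  simp
  ring

theorem normPow_mul {x : Euc N} (hx : x ≠ 0) (s t : ℝ) :
    normPow s x * normPow t x = normPow (s + t) x :=
  (Real.rpow_add (norm_pos_iff.2 hx) s t).symm

theorem normPow_pos {x : Euc N} (hx : x ≠ 0) (s : ℝ) : 0 < normPow s x :=
  Real.rpow_pos_of_pos (norm_pos_iff.2 hx) s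

/-- By induction on k: the polarized Bochner identity expresses the (k+1)-st contraction through
k-th contractions of powers of |x|, and `two_mul_lambdaBilin_succ` is the same recursion.
Polarization is essential, since the step replaces only one of s and t by its value minus 2. -/
theorem gradPair_normPow (k : ℕ) : ∀ s t : ℝ,
    EqOn (gradPair k (normPow s) (normPow t : Euc N → ℝ))
      (fun x => lambdaBilin (((N : ℝ) - 3) / 2) k s t • normPow (s + t - 2 * k) x) {0}ᶜ := by
  induction k with
  | zero =>
    intro s t x hx
    simp [gradPair, lambdaBilin_zero, normPow_mul hx]
  | succ k ih =>
    intro s t x hx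
    have hB := lapl_gradPair isOpen_punctured k (contDiffOn_normPow (N := N) s)
      (contDiffOn_normPow t) hx
    rw [lapl_congr isOpen_punctured (ih s t) hx, lapl_const_smul] at hB
    simp only at hB
    rw [lapl_normPow _ hx, gradPair_congr isOpen_punctured k (lapl_normPow s) (fun _ _ => rfl) hx,
      gradPair_congr isOpen_punctured k (fun _ _ => rfl) (lapl_normPow t) hx,
      gradPair_const_smul_left, gradPair_const_smul_right] at hB
    simp only at hB
    rw [ih _ _ hx, ih _ _ hx] at hB
    simp only [smul_eq_mul] at hB ⊢
    have hr := two_mul_lambdaBilin_succ (((N : ℝ) - 3) / 2) k s t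
    rw [show s - 2 + t - 2 * (k : ℝ) = s + t - 2 * k - 2 by ring,
      show s + (t - 2) - 2 * (k : ℝ) = s + t - 2 * k - 2 by ring] at hB
    rw [show s + t - 2 * ((k + 1 : ℕ) : ℝ) = s + t - 2 * k - 2 by push_cast; ring]
    rw [show (2 * (((N : ℝ) - 3) / 2) + 1) = N - 2 by ring] at hr
    linear_combination (-1 / 2) * hB - normPow (s + t - 2 * k - 2) x / 2 * hr

end PuncturedCalculus

/-! ### Integration by parts against powers of |x|, for functions supported away from the origin. -/

section PuncturedIntegration

open Set MeasureTheory

variable {N : ℕ} {F : Type*} [NormedAddCommGroup F] [NormedSpace ℝ F]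

/-- Smooth functions with compact support in the punctured space. -/
structure PuncturedTest (f : Euc N → F) : Prop where
  contDiff : ContDiff ℝ ∞ f
  hasCompactSupport : HasCompactSupport f
  zero_notMem : (0 : Euc N) ∉ tsupport f

variable {f g : Euc N → F} {p : Euc N → ℝ}

/-- Smoothness off the origin is enough: g vanishes near 0 because the support of f stays away from
it. -/
theorem PuncturedTest.of_support_subset (hf : PuncturedTest f) (hg : ContDiffOn ℝ ∞ g {0}ᶜ)
    (h : Function.support g ⊆ tsupport f) : PuncturedTest g := by
  have ht : tsupport g ⊆ tsupport f := closure_minimal h (isClosed_tsupport f)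
  refine ⟨contDiff_iff_contDiffAt.2 fun x => ?_,
    hf.hasCompactSupport.of_isClosed_subset (isClosed_tsupport g) ht,
    fun h0 => hf.zero_notMem (ht h0)⟩
  by_cases hx : x ∈ tsupport g
  · refine hg.contDiffAt (isOpen_punctured.mem_nhds ?_)
    rintro rfl
    exact hf.zero_notMem (ht hx)
  · exact contDiffAt_const.congr_of_eventuallyEq (notMem_tsupport_iff_eventuallyEq.1 hx)

theorem gradPair_zero_right (k : ℕ) : ∀ p : Euc N → ℝ, gradPair k p (0 : Euc N → F) = 0 := by
  intro p
  have := gradPair_const_smul_right k 0 p (0 : Euc N → F)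
  simp only [zero_smul] at this
  exact this

theorem gradPair_eq_zero_of_notMem (k : ℕ) (p : Euc N → ℝ) {x : Euc N} (hx : x ∉ tsupport f) :
    gradPair k p f x = 0 := by
  have h : EqOn f 0 (tsupport f)ᶜ := fun y hy => image_eq_zero_of_notMem_tsupport hy
  rw [gradPair_congr (isClosed_tsupport f).isOpen_compl k (fun _ _ => rfl) h hx,
    gradPair_zero_right]
  rfl

theorem lapl_eq_zero_of_notMem {x : Euc N} (hx : x ∉ tsupport f) : lapl f x = 0 := by
  have h : EqOn f (fun x => (0 : ℝ) • (0 : Euc N → F) x) (tsupport f)ᶜ := fun y hy => by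
    simpa using image_eq_zero_of_notMem_tsupport hy
  rw [lapl_congr (isClosed_tsupport f).isOpen_compl h hx, lapl_const_smul]
  simp

theorem support_partialD_subset (f : Euc N → F) (a : Fin N) :
    Function.support (partialD a f) ⊆ tsupport f := by
  intro x hx
  refine support_fderiv_subset ℝ fun h => hx ?_
  simp [partialD, h]

theorem support_lapl_subset (f : Euc N → F) : Function.support (lapl f) ⊆ tsupport f := fun x hx => by
  by_contra h
  exact hx (lapl_eq_zero_of_notMem h)

theorem PuncturedTest.partialD (hf : PuncturedTest f) (a : Fin N) : PuncturedTest (partialD a f) :=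
  hf.of_support_subset (hf.contDiff.partialD a).contDiffOn (support_partialD_subset f a)

theorem PuncturedTest.lapl (hf : PuncturedTest f) : PuncturedTest (lapl f) :=
  hf.of_support_subset hf.contDiff.lapl.contDiffOn (support_lapl_subset f)

theorem PuncturedTest.smul (hf : PuncturedTest f) (hp : ContDiffOn ℝ ∞ p {0}ᶜ) :
    PuncturedTest fun x => p x • f x := by
  refine hf.of_support_subset (hp.smul hf.contDiff.contDiffOn) fun x hx => subset_tsupport f ?_
  intro h
  simp [h] at hx

theorem PuncturedTest.gradPair (hf : PuncturedTest f) (hp : ContDiffOn ℝ ∞ p {0}ᶜ) (k : ℕ) :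
    PuncturedTest (gradPair k p f) := by
  refine hf.of_support_subset (ContDiffOn.gradPair isOpen_punctured k hp hf.contDiff.contDiffOn)
    fun x hx => ?_
  by_contra h
  exact hx (gradPair_eq_zero_of_notMem k p h)

theorem PuncturedTest.ne_zero (hf : PuncturedTest f) {x : Euc N} (hx : x ∈ tsupport f) :
    x ∈ ({0}ᶜ : Set (Euc N)) := by
  rintro rfl
  exact hf.zero_notMem hx

theorem PuncturedTest.integrable (hf : PuncturedTest f) : Integrable f :=
  hf.contDiff.continuous.integrable_of_hasCompactSupport hf.hasCompactSupport

theorem PuncturedTest.integral_smul_partialD (hf : PuncturedTest f) (hp : ContDiffOn ℝ ∞ p {0}ᶜ)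
    (a : Fin N) : ∫ x, p x • _root_.partialD a f x = -∫ x, _root_.partialD a p x • f x := by
  refine integral_smul_fderiv_eq_neg_fderiv_smul_of_integrable
    (hf.smul (hp.partialD isOpen_punctured a)).integrable
    ((hf.partialD a).smul hp).integrable (hf.smul hp).integrable (fun x hx => ?_)
    (fun x _ => hf.contDiff.contDiffAt.differentiableAt (by simp))
  exact hp.differentiableAt_of_isOpen isOpen_punctured (hf.ne_zero hx)

theorem PuncturedTest.integral_smul_lapl (hf : PuncturedTest f) (hp : ContDiffOn ℝ ∞ p {0}ᶜ) :
    ∫ x, p x • _root_.lapl f x = ∫ x, _root_.lapl p x • f x := by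
  simp only [_root_.lapl, Finset.smul_sum, Finset.sum_smul]
  rw [integral_finsetSum _ fun a _ => (((hf.partialD a).partialD a).smul hp).integrable,
    integral_finsetSum _ fun a _ => (hf.smul ((hp.partialD isOpen_punctured a).partialD
      isOpen_punctured a)).integrable]
  refine Finset.sum_congr rfl fun a _ => ?_
  rw [(hf.partialD a).integral_smul_partialD hp,
    hf.integral_smul_partialD (hp.partialD isOpen_punctured a), neg_neg]

theorem PuncturedTest.integral_normPow_smul_lapl (hf : PuncturedTest f) (b : ℝ) :
    ∫ x, normPow b x • _root_.lapl f x = (b * (b + N - 2)) • ∫ x, normPow (b - 2) x • f x := by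
  rw [hf.integral_smul_lapl (contDiffOn_normPow b), ← integral_smul]
  refine integral_congr_ae (Filter.Eventually.of_forall fun x => ?_)
  by_cases hx : x ∈ tsupport f
  · simp only [lapl_normPow b (hf.ne_zero hx), smul_eq_mul, mul_smul]
  · simp only [image_eq_zero_of_notMem_tsupport hx, smul_zero]

/-- Off the support of f every term is zero, so the Bochner identity holds at all points, the origin
included, and can be integrated. -/
theorem two_smul_gradPair_normPow_succ (hf : PuncturedTest f) (k : ℕ) (s : ℝ) (x : Euc N) :
    (2 : ℝ) • gradPair (k + 1) (normPow s) f x = lapl (gradPair k (normPow s) f) x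
      - (s * (s + N - 2)) • gradPair k (normPow (s - 2)) f x - gradPair k (normPow s) (lapl f) x := by
  by_cases hx : x ∈ tsupport f
  · have hB := lapl_gradPair isOpen_punctured k (contDiffOn_normPow s) hf.contDiff.contDiffOn
      (hf.ne_zero hx)
    simp only at hB
    rw [gradPair_congr isOpen_punctured k (lapl_normPow s) (fun _ _ => rfl) (hf.ne_zero hx),
      gradPair_const_smul_left] at hB
    rw [hB]
    abel
  · have hx' : x ∉ tsupport (gradPair k (normPow s) f) := fun h =>
      hx (closure_minimal (fun y hy => by
        by_contra h'
        exact hy (gradPair_eq_zero_of_notMem k _ h')) (isClosed_tsupport f) h)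
    have hx'' : x ∉ tsupport (lapl f) := fun h =>
      hx (closure_minimal (support_lapl_subset f) (isClosed_tsupport f) h)
    rw [gradPair_eq_zero_of_notMem _ _ hx, gradPair_eq_zero_of_notMem _ _ hx,
      lapl_eq_zero_of_notMem hx', gradPair_eq_zero_of_notMem _ _ hx'']
    simp

/-- The exponent t = 2k - N - b - s is the one for which |x|^(b+s-2k) |x|^t = |x|^(-N). Integrating
the Bochner identity by parts produces factors β(β + N - 2), which are invariant under β ↦ 2 - N -
β. This symmetry turns the factors for b and b + s - 2k into those for s + t - 2k and t (t taken at
level k + 1), so that the constants obey `two_mul_lambdaBilin_succ`. -/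
theorem integral_normPow_gradPair (k : ℕ) : ∀ (b s : ℝ) (f : Euc N → F), PuncturedTest f →
    ∫ x, normPow b x • gradPair k (normPow s) f x =
      lambdaBilin (((N : ℝ) - 3) / 2) k s (2 * k - N - b - s) •
        ∫ x, normPow (b + s - 2 * k) x • f x := by
  induction k with
  | zero =>
    intro b s f hf
    rw [lambdaBilin_zero, one_smul]
    refine integral_congr_ae (Filter.Eventually.of_forall fun x => ?_)
    by_cases hx : x ∈ tsupport f
    · simp only [gradPair, smul_smul, normPow_mul (hf.ne_zero hx)]
      simp
    · simp only [gradPair, image_eq_zero_of_notMem_tsupport hx, smul_zero]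
  | succ k ih =>
    intro b s f hf
    have hp := contDiffOn_normPow (N := N)
    have i₁ := (hf.gradPair (hp s) k).lapl.smul (hp b) |>.integrable
    have i₂ := (hf.gradPair (hp (s - 2)) k).smul (hp b) |>.integrable
    have i₃ := (hf.lapl.gradPair (hp s) k).smul (hp b) |>.integrable
    have i₂' : Integrable fun x =>
      (s * (s + N - 2)) • (normPow b x • gradPair k (normPow (s - 2)) f x) := i₂.smul _
    have i₁₂ : Integrable fun x => normPow b x • lapl (gradPair k (normPow s) f) x -
      (s * (s + N - 2)) • (normPow b x • gradPair k (normPow (s - 2)) f x) := i₁.sub i₂'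
    have h2 : (2 : ℝ) • ∫ x, normPow b x • gradPair (k + 1) (normPow s) f x =
        (∫ x, normPow b x • lapl (gradPair k (normPow s) f) x)
        - (s * (s + N - 2)) • (∫ x, normPow b x • gradPair k (normPow (s - 2)) f x)
        - ∫ x, normPow b x • gradPair k (normPow s) (lapl f) x := by
      rw [← integral_smul, ← integral_smul, ← integral_sub i₁ i₂', ← integral_sub i₁₂ i₃]
      refine integral_congr_ae (Filter.Eventually.of_forall fun x => ?_)
      simp only
      rw [smul_comm, two_smul_gradPair_normPow_succ hf, smul_sub, smul_sub, smul_comm (normPow b x)]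
    rw [(hf.gradPair (hp s) k).integral_normPow_smul_lapl, ih _ _ _ hf, ih _ _ _ hf,
      ih _ _ _ hf.lapl, hf.integral_normPow_smul_lapl] at h2
    have hr := two_mul_lambdaBilin_succ (((N : ℝ) - 3) / 2) k s (2 * (k + 1 : ℕ) - N - b - s)
    push_cast at hr ⊢
    rw [show b - 2 + s - 2 * (k : ℝ) = b + s - 2 * (k + 1) by ring,
      show b + (s - 2) - 2 * (k : ℝ) = b + s - 2 * (k + 1) by ring,
      show b + s - 2 * (k : ℝ) - 2 = b + s - 2 * (k + 1) by ring,
      show 2 * (k : ℝ) - N - (b - 2) - s = 2 * (k + 1) - N - b - s by ring,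
      show 2 * (k : ℝ) - N - b - (s - 2) = 2 * (k + 1) - N - b - s by ring,
      show 2 * (k : ℝ) - N - b - s = 2 * (k + 1) - N - b - s - 2 by ring, smul_smul, smul_smul,
      smul_smul, ← sub_smul, ← sub_smul] at h2
    have h3 := congrArg (fun v => (1 / 2 : ℝ) • v) h2
    simp only [smul_smul] at h3
    rw [show (1 / 2 : ℝ) * 2 = 1 by norm_num, one_smul] at h3
    rw [h3]
    congr 1
    linear_combination (-1 / 2) * hr

end PuncturedIntegration

/-! ### Cauchy–Schwarz for the dual field, and removal of the support condition by cutoffs. -/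

section Cutoff

open Set MeasureTheory Filter Topology

variable {N : ℕ} {F : Type*} [NormedAddCommGroup F] [NormedSpace ℝ F]

/-- The Euclidean norm of the family of the partial derivatives of order `k`. -/
noncomputable def tensorNorm (k : ℕ) (f : Euc N → F) (x : Euc N) : ℝ :=
  Real.sqrt (∑ i : Fin k → Fin N,
    ‖iteratedFDeriv ℝ k f x (fun j => EuclideanSpace.single (i j) (1 : ℝ))‖ ^ 2)

theorem tensorNorm_nonneg (k : ℕ) (f : Euc N → F) (x : Euc N) : 0 ≤ tensorNorm k f x :=
  Real.sqrt_nonneg _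

theorem tensorNorm_congr {f g : Euc N → F} {x : Euc N} (k : ℕ) (h : f =ᶠ[𝓝 x] g) :
    tensorNorm k f x = tensorNorm k g x := by
  simp only [tensorNorm, (h.iteratedFDeriv ℝ k).eq_of_nhds]

theorem norm_gradPair_le {U : Set (Euc N)} (hU : IsOpen U) (k : ℕ) {p : Euc N → ℝ} {f : Euc N → F}
    (hp : ContDiffOn ℝ ∞ p U) (hf : ContDiffOn ℝ ∞ f U) {x : Euc N} (hx : x ∈ U) :
    ‖gradPair k p f x‖ ≤ tensorNorm k p x * tensorNorm k f x := by
  rw [gradPair_eq_sum hU k hp hf x hx]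
  refine (norm_sum_le _ _).trans ?_
  simp only [norm_smul]
  exact Real.sum_mul_le_sqrt_mul_sqrt _ _ _

theorem tensorNorm_eq_sqrt_gradPair {U : Set (Euc N)} (hU : IsOpen U) (k : ℕ) {p : Euc N → ℝ}
    (hp : ContDiffOn ℝ ∞ p U) {x : Euc N} (hx : x ∈ U) :
    tensorNorm k p x = Real.sqrt (gradPair k p p x) := by
  rw [gradPair_eq_sum hU k hp hp x hx, tensorNorm]
  congr 1
  refine Finset.sum_congr rfl fun i _ => ?_
  rw [smul_eq_mul, Real.norm_eq_abs, sq_abs, sq]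

theorem tensorNorm_le (k : ℕ) (f : Euc N → F) (x : Euc N) :
    tensorNorm k f x ≤ Real.sqrt (N ^ k) * ‖iteratedFDeriv ℝ k f x‖ := by
  rw [tensorNorm, Real.sqrt_le_left (by positivity), mul_pow, Real.sq_sqrt (by positivity)]
  have : ∀ i : Fin k → Fin N,
      ‖iteratedFDeriv ℝ k f x (fun j => EuclideanSpace.single (i j) (1 : ℝ))‖ ^ 2 ≤
        ‖iteratedFDeriv ℝ k f x‖ ^ 2 := by
    intro i
    have := (iteratedFDeriv ℝ k f x).le_opNorm (fun j => EuclideanSpace.single (i j) (1 : ℝ))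
    simp only [PiLp.norm_single, norm_one, Finset.prod_const_one, mul_one] at this
    gcongr
  refine (Finset.sum_le_sum fun i _ => this i).trans ?_
  simp

/-- Reduces integrability of the operator norm of a derivative to that of its components. -/
theorem norm_multilinear_le_sum {k : ℕ}
    (M : ContinuousMultilinearMap ℝ (fun _ : Fin k => Euc N) F) :
    ‖M‖ ≤ ∑ i : Fin k → Fin N, ‖M (fun j => EuclideanSpace.single (i j) (1 : ℝ))‖ := by
  refine M.opNorm_le_bound (Finset.sum_nonneg fun _ _ => norm_nonneg _) fun v => ?_
  have hv : ∀ j, v j = ∑ a : Fin N, (v j) a • (EuclideanSpace.single a (1 : ℝ) : Euc N) := by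
    intro j
    have := (EuclideanSpace.basisFun (Fin N) ℝ).sum_repr (v j)
    simpa using this.symm
  have : M v = ∑ i : Fin k → Fin N, (∏ j, v j (i j)) •
      M (fun j => EuclideanSpace.single (i j) (1 : ℝ)) := by
    conv_lhs => rw [show v = fun j => ∑ a : Fin N, (v j) a •
      (EuclideanSpace.single a (1 : ℝ) : Euc N) from funext hv]
    rw [M.map_sum]
    simp_rw [M.map_smul_univ]
  rw [this, Finset.sum_mul]
  refine (norm_sum_le _ _).trans (Finset.sum_le_sum fun i _ => ?_)
  rw [norm_smul, norm_prod, mul_comm]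
  gcongr with j
  exact PiLp.norm_apply_le (v j) (i j)

theorem tensorNorm_normPow (k : ℕ) {x : Euc N} (hx : x ≠ 0) :
    tensorNorm k (normPow ((k : ℝ) - N) : Euc N → ℝ) x =
      Real.sqrt (lambdaConst N ((k : ℝ) - N) k) * normPow (-N) x := by
  rw [tensorNorm_eq_sqrt_gradPair isOpen_punctured k (contDiffOn_normPow _) hx,
    gradPair_normPow k _ _ hx, ← lambdaConst_eq]
  simp only [smul_eq_mul]
  rw [show (k : ℝ) - N + (k - N) - 2 * k = -N + -N by ring, ← normPow_mul hx,
    Real.sqrt_mul' _ (mul_self_nonneg _), Real.sqrt_mul_self (normPow_pos hx _).le]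

/-- Cauchy–Schwarz: the weight |x|^N exactly cancels the decay of |∇^k |x|^(k-N)| = √λ |x|^(-N). -/
theorem norm_weighted_gradPair_le (k : ℕ) {f : Euc N → F} (hf : ContDiff ℝ ∞ f) {x : Euc N}
    (hx : x ≠ 0) : ‖normPow N x • gradPair k (normPow ((k : ℝ) - N)) f x‖ ≤
      Real.sqrt (lambdaConst N ((k : ℝ) - N) k) * tensorNorm k f x := by
  have h := norm_gradPair_le isOpen_punctured k (contDiffOn_normPow ((k : ℝ) - N)) hf.contDiffOn hx
  have hN := normPow_pos hx (N : ℝ)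
  rw [tensorNorm_normPow k hx] at h
  rw [norm_smul, Real.norm_of_nonneg hN.le]
  refine (mul_le_mul_of_nonneg_left h hN.le).trans (le_of_eq ?_)
  have h1 : normPow N x * normPow (-N) x = 1 := by
    rw [normPow_mul hx, add_neg_cancel, normPow, Real.rpow_zero]
  linear_combination (Real.sqrt (lambdaConst N ((k : ℝ) - N) k) * tensorNorm k f x) * h1

/-- The standard bump function, equal to `1` on the unit ball and supported in the ball of
radius `2`. -/
noncomputable def stdBump (N : ℕ) : ContDiffBump (0 : Euc N) := ⟨1, 2, one_pos, one_lt_two⟩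

/-- Smooth cutoff functions which vanish near the origin and near infinity. -/
noncomputable def annularCutoff (n : ℕ) (x : Euc N) : ℝ :=
  stdBump N (((n : ℝ) + 1)⁻¹ • x) - stdBump N (((n : ℝ) + 1) • x)

theorem contDiff_bump_smul (c : ℝ) : ContDiff ℝ ∞ fun x : Euc N => stdBump N (c • x) :=
  (stdBump N).contDiff.comp (contDiff_const_smul c)

theorem contDiff_annularCutoff (n : ℕ) : ContDiff ℝ ∞ (annularCutoff n : Euc N → ℝ) :=
  (contDiff_bump_smul _).sub (contDiff_bump_smul _)

theorem stdBump_eq_one {x : Euc N} (hx : ‖x‖ ≤ 1) : stdBump N x = 1 :=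
  (stdBump N).one_of_mem_closedBall (by simpa [stdBump] using hx)

theorem stdBump_eq_zero {x : Euc N} (hx : 2 ≤ ‖x‖) : stdBump N x = 0 :=
  (stdBump N).zero_of_le_dist (by simpa [stdBump] using hx)

theorem annularCutoff_eq_zero (n : ℕ) {x : Euc N}
    (hx : ‖x‖ < ((n : ℝ) + 1)⁻¹ ∨ 2 * ((n : ℝ) + 1) < ‖x‖) : annularCutoff n x = 0 := by
  have hn : (1 : ℝ) ≤ n + 1 := by simp
  have hn' : ((n : ℝ) + 1)⁻¹ ≤ 1 := inv_le_one_of_one_le₀ hn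
  have hpos : 0 < (n : ℝ) + 1 := by positivity
  rw [annularCutoff]
  rcases hx with h | h
  · rw [stdBump_eq_one, stdBump_eq_one, sub_self]
    · rw [norm_smul, Real.norm_of_nonneg hpos.le]
      calc ((n : ℝ) + 1) * ‖x‖ ≤ ((n : ℝ) + 1) * ((n : ℝ) + 1)⁻¹ := by gcongr
        _ = 1 := mul_inv_cancel₀ hpos.ne'
    · rw [norm_smul, Real.norm_of_nonneg (inv_nonneg.2 hpos.le)]
      calc ((n : ℝ) + 1)⁻¹ * ‖x‖ ≤ 1 * 1 := by gcongr; exact h.le.trans hn'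
        _ = 1 := mul_one 1
  · rw [stdBump_eq_zero, stdBump_eq_zero, sub_self]
    · rw [norm_smul, Real.norm_of_nonneg hpos.le]
      nlinarith
    · rw [norm_smul, Real.norm_of_nonneg (inv_nonneg.2 hpos.le), inv_mul_eq_div, le_div_iff₀ hpos]
      exact h.le

theorem annularCutoff_eventually_eq_one {x : Euc N} (hx : x ≠ 0) :
    ∀ᶠ n : ℕ in atTop, annularCutoff n =ᶠ[𝓝 x] (fun _ : Euc N => (1 : ℝ)) := by
  have hx0 : 0 < ‖x‖ := norm_pos_iff.2 hx
  obtain ⟨n₀, hn₀⟩ := exists_nat_gt (max (4 / ‖x‖) (2 * ‖x‖))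
  filter_upwards [eventually_ge_atTop n₀] with n hn
  have hn1 : (n₀ : ℝ) ≤ n := by exact_mod_cast hn
  have h1 : 4 / ‖x‖ < n + 1 := by linarith [le_max_left (4 / ‖x‖) (2 * ‖x‖)]
  have h2 : 2 * ‖x‖ < n + 1 := by linarith [le_max_right (4 / ‖x‖) (2 * ‖x‖)]
  have hpos : 0 < (n : ℝ) + 1 := by positivity
  rw [div_lt_iff₀ hx0] at h1
  have hball : ∀ᶠ y : Euc N in 𝓝 x, ‖x‖ / 2 < ‖y‖ ∧ ‖y‖ < 2 * ‖x‖ :=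
    (continuous_norm.continuousAt.eventually (lt_mem_nhds (by linarith))).and
      (continuous_norm.continuousAt.eventually (gt_mem_nhds (by linarith)))
  filter_upwards [hball] with y hy
  rw [annularCutoff, stdBump_eq_one, stdBump_eq_zero, sub_zero]
  · rw [norm_smul, Real.norm_of_nonneg hpos.le]
    nlinarith
  · rw [norm_smul, Real.norm_of_nonneg (inv_nonneg.2 hpos.le), inv_mul_eq_div, div_le_one hpos]
    linarith

/-- The quantity |y|^j |∇^j θ(y)| is invariant under dilations of the bump θ and bounded by
compactness, so C does not depend on n. -/
theorem norm_iteratedFDeriv_annularCutoff_le (j : ℕ) : ∃ C : ℝ, 0 ≤ C ∧ ∀ (n : ℕ) (x : Euc N),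
    x ≠ 0 → ‖iteratedFDeriv ℝ j (annularCutoff n : Euc N → ℝ) x‖ ≤ C * normPow (-j) x := by
  have hθ : ContDiff ℝ ∞ (stdBump N : Euc N → ℝ) := (stdBump N).contDiff
  have hcont : Continuous fun y : Euc N =>
      ‖iteratedFDeriv ℝ j (stdBump N : Euc N → ℝ) y‖ * ‖y‖ ^ j :=
    ((hθ.continuous_iteratedFDeriv (by exact_mod_cast le_top)).norm).mul (continuous_norm.pow j)
  have hsupp : HasCompactSupport fun y : Euc N =>
      ‖iteratedFDeriv ℝ j (stdBump N : Euc N → ℝ) y‖ * ‖y‖ ^ j :=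
    (((stdBump N).hasCompactSupport.iteratedFDeriv j).norm).mul_right
  obtain ⟨C, hC⟩ := hcont.bounded_above_of_compact_support hsupp
  have hC0 : 0 ≤ C := (norm_nonneg _).trans (hC 0)
  have key : ∀ c : ℝ, 0 < c → ∀ x : Euc N, x ≠ 0 →
      ‖iteratedFDeriv ℝ j (fun x : Euc N => stdBump N (c • x)) x‖ ≤ C * normPow (-j) x := by
    intro c hc x hx
    have hx0 : 0 < ‖x‖ := norm_pos_iff.2 hx
    rw [iteratedFDeriv_comp_const_smul c ((stdBump N).contDiff (n := j))]
    have h := hC (c • x)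
    rw [norm_smul, Real.norm_of_nonneg (by positivity), Real.norm_of_nonneg hc.le, mul_pow] at h
    rw [norm_smul, Real.norm_of_nonneg (by positivity), normPow, Real.rpow_neg hx0.le,
      Real.rpow_natCast, ← div_eq_mul_inv, le_div_iff₀ (by positivity)]
    linarith
  refine ⟨C + C, by positivity, fun n x hx => ?_⟩
  have hpos : 0 < (n : ℝ) + 1 := by positivity
  have hsub : (annularCutoff n : Euc N → ℝ) = (fun x : Euc N => stdBump N (((n : ℝ) + 1)⁻¹ • x)) -
      fun x : Euc N => stdBump N (((n : ℝ) + 1) • x) := rfl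
  rw [hsub, iteratedFDeriv_sub_apply
    ((contDiff_bump_smul _).contDiffAt.of_le (by exact_mod_cast le_top))
    ((contDiff_bump_smul _).contDiffAt.of_le (by exact_mod_cast le_top)), add_mul]
  exact (norm_sub_le _ _).trans (add_le_add (key _ (inv_pos.2 hpos) x hx) (key _ hpos x hx))

theorem puncturedTest_annularCutoff_smul (n : ℕ) {f : Euc N → F} (hf : ContDiff ℝ ∞ f) :
    PuncturedTest fun x => annularCutoff n x • f x := by
  have hpos : 0 < (n : ℝ) + 1 := by positivity
  refine ⟨(contDiff_annularCutoff n).smul hf, ?_, ?_⟩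
  · refine HasCompactSupport.of_support_subset_isCompact
      (isCompact_closedBall (0 : Euc N) (2 * ((n : ℝ) + 1))) fun x hx => ?_
    by_contra h
    rw [mem_closedBall_zero_iff, not_le] at h
    simp [annularCutoff_eq_zero n (Or.inr h)] at hx
  · rw [notMem_tsupport_iff_eventuallyEq]
    filter_upwards [Metric.ball_mem_nhds (0 : Euc N) (inv_pos.2 hpos)] with x hx
    rw [mem_ball_zero_iff] at hx
    simp [annularCutoff_eq_zero n (Or.inl hx)]

theorem measurable_normPow (s : ℝ) : Measurable (normPow s : Euc N → ℝ) :=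
  measurable_norm.pow_const s

/-- On the unit ball g is bounded and |x|^(-r) is integrable; outside it the weight is at most 1. -/
theorem integrable_normPow_neg_mul {r : ℝ} (hr : 0 ≤ r) (hrN : r < N) {g : Euc N → ℝ}
    (hg : Continuous g) (hi : Integrable g) : Integrable fun x => normPow (-r) x * g x := by
  have hfin : Module.finrank ℝ (Euc N) = N := finrank_euclideanSpace_fin
  have hN : 1 ≤ N := by
    have : (0 : ℝ) < N := hr.trans_lt hrN
    exact_mod_cast this
  have hmeas : AEStronglyMeasurable (fun x : Euc N => normPow (-r) x * g x) volume :=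
    ((measurable_normPow _).mul hg.measurable).aestronglyMeasurable
  obtain ⟨C, hC⟩ := (isCompact_closedBall (0 : Euc N) 1).exists_bound_of_continuousOn
    hg.continuousOn
  have h1 : IntegrableOn (fun x : Euc N => normPow (-r) x * g x) (Metric.ball 0 1) := by
    refine integrableOn_ball_of_norm_le_rpow (by rw [hfin]; exact hN) (C := C) (α := r)
      (by rw [hfin]; exact hrN) ?_ hmeas
    refine (ae_restrict_mem measurableSet_ball).mono fun x hx => ?_
    rw [norm_mul, normPow, Real.norm_of_nonneg (Real.rpow_nonneg (norm_nonneg _) _), mul_comm]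
    gcongr
    exact hC x (Metric.ball_subset_closedBall hx)
  have h2 : IntegrableOn (fun x : Euc N => normPow (-r) x * g x) (Metric.ball 0 1)ᶜ := by
    refine hi.norm.integrableOn.mono' hmeas.restrict ?_
    refine (ae_restrict_mem measurableSet_ball.compl).mono fun x hx => ?_
    have hx1 : 1 ≤ ‖x‖ := by simpa using hx
    rw [norm_mul, normPow, Real.norm_of_nonneg (Real.rpow_nonneg (norm_nonneg _) _)]
    exact mul_le_of_le_one_left (norm_nonneg _) (Real.rpow_le_one_of_one_le_of_nonpos hx1 (by linarith))
  rw [← integrableOn_univ, ← union_compl_self (Metric.ball (0 : Euc N) 1)]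
  exact h1.union h2

theorem ae_ne_zero (hN : 1 ≤ N) : ∀ᵐ x : Euc N, x ≠ 0 := by
  have : Nontrivial (Euc N) :=
    Module.nontrivial_of_finrank_pos (R := ℝ) (by rw [finrank_euclideanSpace_fin]; omega)
  exact compl_mem_ae_iff.2 (measure_singleton 0)

/-- The duality identity between `∇^k |x|^(k-N)` and the `k`-th derivatives of a function. -/
theorem integral_gradPair_eq {k : ℕ} (hkN : k < N) {f : Euc N → F} (hf : ContDiff ℝ ∞ f)
    (hi : ∀ j ≤ k, Integrable fun x => ‖iteratedFDeriv ℝ j f x‖) :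
    ∫ x, normPow N x • gradPair k (normPow ((k : ℝ) - N)) f x =
      lambdaConst N ((k : ℝ) - N) k • ∫ x, normPow (-k) x • f x := by
  choose C hC0 hC using fun j => norm_iteratedFDeriv_annularCutoff_le (N := N) j
  have hcutoff : ∀ n : ℕ, ∫ x, normPow N x • gradPair k (normPow ((k : ℝ) - N))
      (fun x => annularCutoff n x • f x) x = lambdaConst N ((k : ℝ) - N) k •
        ∫ x, normPow (-k) x • (annularCutoff n x • f x) := by
    intro n
    have h := integral_normPow_gradPair k N ((k : ℝ) - N) _ (puncturedTest_annularCutoff_smul n hf)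
    -- For b = N and s = k - N the dual exponent is again k - N, so the bilinear constant becomes λ
    -- itself.
    rw [show 2 * (k : ℝ) - N - N - (k - N) = k - N by ring,
      show (N : ℝ) + (k - N) - 2 * k = -k by ring, ← lambdaConst_eq] at h
    exact h
  have hcd : ∀ j, Continuous fun x => ‖iteratedFDeriv ℝ j f x‖ := fun j =>
    (hf.continuous_iteratedFDeriv (by exact_mod_cast le_top)).norm
  have hlim₁ : Tendsto (fun n : ℕ => ∫ x, normPow N x • gradPair k (normPow ((k : ℝ) - N))
      (fun x => annularCutoff n x • f x) x) atTop
      (𝓝 (∫ x, normPow N x • gradPair k (normPow ((k : ℝ) - N)) f x)) := by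
    refine tendsto_integral_of_dominated_convergence
      (fun x => Real.sqrt (lambdaConst N ((k : ℝ) - N) k) * (Real.sqrt (N ^ k) *
        ∑ i ∈ Finset.range (k + 1), k.choose i * C i *
          (normPow (-i) x * ‖iteratedFDeriv ℝ (k - i) f x‖))) (fun n => ?_) ?_ (fun n => ?_) ?_
    · exact (((puncturedTest_annularCutoff_smul n hf).gradPair (contDiffOn_normPow _) k).smul
        (contDiffOn_normPow _)).integrable.aestronglyMeasurable
    · refine Integrable.const_mul (Integrable.const_mul (integrable_finsetSum _ fun i hi' => ?_) _) _
      have hik : i ≤ k := Nat.lt_succ_iff.1 (Finset.mem_range.1 hi')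
      exact (integrable_normPow_neg_mul (Nat.cast_nonneg i)
        (by exact_mod_cast hik.trans_lt hkN) (hcd _) (hi _ (Nat.sub_le _ _))).const_mul _
    · filter_upwards [ae_ne_zero (by omega : 1 ≤ N)] with x hx
      have hs : ContDiff ℝ ∞ fun x => annularCutoff n x • f x :=
        (contDiff_annularCutoff n).smul hf
      refine (norm_weighted_gradPair_le k hs hx).trans ?_
      gcongr
      refine (tensorNorm_le _ _ _).trans ?_
      gcongr
      -- By the Leibniz rule, i derivatives on the cutoff cost |x|^(-i) uniformly in n; this is
      -- integrable against the derivatives of f because i ≤ k < N.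
      refine (norm_iteratedFDeriv_smul_le (contDiff_annularCutoff n) hf x
        (by exact_mod_cast le_top)).trans (Finset.sum_le_sum fun i _ => ?_)
      rw [mul_assoc, mul_assoc, ← mul_assoc (C i)]
      gcongr
      exact hC i n x hx
    · filter_upwards [ae_ne_zero (by omega : 1 ≤ N)] with x hx
      refine tendsto_const_nhds.congr' ?_
      filter_upwards [annularCutoff_eventually_eq_one hx] with n hn
      obtain ⟨V, hVx, hV, hVo⟩ := eventually_nhds_iff.1 hn
      rw [gradPair_congr hV k (fun _ _ => rfl) (fun y hy => ?_) hVo]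
      simp [hVx y hy]
  have hlim₂ : Tendsto (fun n : ℕ => ∫ x, normPow (-k) x • (annularCutoff n x • f x)) atTop
      (𝓝 (∫ x, normPow (-k) x • f x)) := by
    refine tendsto_integral_of_dominated_convergence
      (fun x => C 0 * (normPow (-k) x * ‖iteratedFDeriv ℝ 0 f x‖)) (fun n => ?_) ?_ (fun n => ?_) ?_
    · exact ((puncturedTest_annularCutoff_smul n hf).smul
        (contDiffOn_normPow _)).integrable.aestronglyMeasurable
    · exact (integrable_normPow_neg_mul (Nat.cast_nonneg k) (by exact_mod_cast hkN) (hcd _)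
        (hi _ (Nat.zero_le _))).const_mul _
    · filter_upwards [ae_ne_zero (by omega : 1 ≤ N)] with x hx
      have h := hC 0 n x hx
      simp only [norm_iteratedFDeriv_zero, normPow, CharP.cast_eq_zero, neg_zero, Real.rpow_zero,
        mul_one] at h ⊢
      rw [norm_smul, norm_smul, Real.norm_of_nonneg (Real.rpow_nonneg (norm_nonneg _) _)]
      have h0 : 0 ≤ ‖x‖ ^ (-(k : ℝ)) * ‖f x‖ := by positivity
      nlinarith
    · filter_upwards [ae_ne_zero (by omega : 1 ≤ N)] with x hx
      refine tendsto_const_nhds.congr' ?_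
      filter_upwards [annularCutoff_eventually_eq_one hx] with n hn
      rw [hn.eq_of_nhds, one_smul]
  refine tendsto_nhds_unique hlim₁ ?_
  simp only [hcutoff]
  exact hlim₂.const_smul _

end Cutoff

/-! ### The fractional Laplacian of test functions on the Fourier side. -/

section FourierSide

open Set MeasureTheory Filter Topology

variable {N : ℕ} {F : Type*} [NormedAddCommGroup F] [NormedSpace ℝ F]

/-- Smooth functions with compact support. -/
structure IsTest (u : Euc N → F) : Prop where
  contDiff : ContDiff ℝ ∞ u
  hasCompactSupport : HasCompactSupport u

theorem IsTest.partialD {u : Euc N → F} (hu : IsTest u) (a : Fin N) : IsTest (partialD a u) :=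
  ⟨hu.contDiff.partialD a, hu.hasCompactSupport.of_isClosed_subset (isClosed_tsupport _)
    (closure_minimal (support_partialD_subset u a) (isClosed_tsupport _))⟩

theorem IsTest.lapl {u : Euc N → F} (hu : IsTest u) : IsTest (lapl u) :=
  ⟨hu.contDiff.lapl, hu.hasCompactSupport.of_isClosed_subset (isClosed_tsupport _)
    (closure_minimal (support_lapl_subset u) (isClosed_tsupport _))⟩

theorem IsTest.integrable {u : Euc N → F} (hu : IsTest u) : Integrable u :=
  hu.contDiff.continuous.integrable_of_hasCompactSupport hu.hasCompactSupport

variable {u : Euc N → ℂ}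

theorem IsTest.fourier_eq_schwartz (hu : IsTest u) :
    ∃ f : SchwartzMap (Euc N) ℂ, 𝓕 u = f := by
  refine ⟨𝓕 (hu.hasCompactSupport.toSchwartzMap hu.contDiff), ?_⟩
  rw [SchwartzMap.fourier_coe]
  rfl

theorem IsTest.continuous_fourier (hu : IsTest u) : Continuous (𝓕 u) := by
  obtain ⟨f, hf⟩ := hu.fourier_eq_schwartz
  rw [hf]
  exact f.continuous

theorem IsTest.integrable_pow_mul_fourier (hu : IsTest u) (m : ℕ) :
    Integrable fun ξ => ‖ξ‖ ^ m * ‖𝓕 u ξ‖ := by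
  obtain ⟨f, hf⟩ := hu.fourier_eq_schwartz
  rw [hf]
  exact f.integrable_pow_mul volume m

theorem IsTest.integrable_fourier (hu : IsTest u) : Integrable (𝓕 u) := by
  have := hu.integrable_pow_mul_fourier 0
  simp only [pow_zero, one_mul] at this
  exact (integrable_norm_iff hu.continuous_fourier.aestronglyMeasurable).1 this

theorem IsTest.fourierInv_fourier (hu : IsTest u) : 𝓕⁻ (𝓕 u) = u :=
  hu.contDiff.continuous.fourierInv_fourier_eq hu.integrable hu.integrable_fourier

/-- The Fourier transform of the fractional Laplacian of `u`. -/
noncomputable def fracSymbol (s : ℝ) (u : Euc N → ℂ) (ξ : Euc N) : ℂ :=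
  (((2 * Real.pi * ‖ξ‖) ^ (2 * s) : ℝ) : ℂ) * 𝓕 u ξ

theorem IsTest.continuous_fracSymbol (hu : IsTest u) {s : ℝ} (hs : 0 ≤ s) :
    Continuous (fracSymbol s u) :=
  (Complex.continuous_ofReal.comp ((continuous_const.mul continuous_norm).rpow_const
    fun _ => Or.inr (by positivity))).mul hu.continuous_fourier

theorem rpow_le_one_add_pow {t r : ℝ} (ht : 0 ≤ t) (hr : 0 ≤ r) : t ^ r ≤ 1 + t ^ ⌈r⌉₊ := by
  rcases le_total t 1 with h | h
  · exact (Real.rpow_le_one ht h hr).trans (le_add_of_nonneg_right (by positivity))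
  · have := Real.rpow_le_rpow_of_exponent_le h (Nat.le_ceil r)
    rw [Real.rpow_natCast] at this
    linarith

theorem IsTest.integrable_pow_mul_fracSymbol (hu : IsTest u) {s : ℝ} (hs : 0 ≤ s) (m : ℕ) :
    Integrable fun ξ => ‖ξ‖ ^ m * ‖fracSymbol s u ξ‖ := by
  set M := ⌈2 * s⌉₊
  refine ((hu.integrable_pow_mul_fourier m).add ((hu.integrable_pow_mul_fourier (m + M)).const_mul
    ((2 * Real.pi) ^ M))).mono' ((continuous_norm.pow m).mul
      (hu.continuous_fracSymbol hs).norm).aestronglyMeasurable (Eventually.of_forall fun ξ => ?_)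
  have h := rpow_le_one_add_pow (t := 2 * Real.pi * ‖ξ‖) (r := 2 * s) (by positivity) (by positivity)
  have h0 : 0 ≤ (2 * Real.pi * ‖ξ‖) ^ (2 * s) := by positivity
  rw [Real.norm_of_nonneg (by positivity), fracSymbol, norm_mul, Complex.norm_real,
    Real.norm_of_nonneg h0]
  calc ‖ξ‖ ^ m * ((2 * Real.pi * ‖ξ‖) ^ (2 * s) * ‖𝓕 u ξ‖)
      ≤ ‖ξ‖ ^ m * ((1 + (2 * Real.pi * ‖ξ‖) ^ M) * ‖𝓕 u ξ‖) := by gcongr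
    _ = _ := by simp only [Pi.add_apply]; ring

theorem IsTest.integrable_fracSymbol (hu : IsTest u) {s : ℝ} (hs : 0 ≤ s) :
    Integrable (fracSymbol s u) := by
  have := hu.integrable_pow_mul_fracSymbol hs 0
  simp only [pow_zero, one_mul] at this
  exact (integrable_norm_iff (hu.continuous_fracSymbol hs).aestronglyMeasurable).1 this

theorem fracLaplacian_eq (s : ℝ) (u : Euc N → ℂ) :
    fracLaplacian s u = fun x => 𝓕 (fracSymbol s u) (-x) := by
  ext x
  exact Real.fourierInv_eq_fourier_neg _ _

theorem IsTest.contDiff_fracLaplacian (hu : IsTest u) {s : ℝ} (hs : 0 ≤ s) :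
    ContDiff ℝ ∞ (fracLaplacian s u) := by
  rw [fracLaplacian_eq]
  exact (Real.contDiff_fourier (N := ⊤)
    fun n _ => hu.integrable_pow_mul_fracSymbol hs n).comp contDiff_neg

theorem innerSL_single (ξ : Euc N) (a : Fin N) :
    (innerSL ℝ : Euc N →L[ℝ] Euc N →L[ℝ] ℝ) ξ (EuclideanSpace.single a (1 : ℝ)) = ξ a := by
  change inner ℝ ξ _ = _
  simp [EuclideanSpace.inner_single_right]

theorem IsTest.fourier_partialD (hu : IsTest u) (a : Fin N) (ξ : Euc N) :
    𝓕 (_root_.partialD a u) ξ = 2 * Real.pi * Complex.I * ξ a * 𝓕 u ξ := by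
  have hd : Integrable (fderiv ℝ u) :=
    (hu.contDiff.continuous_fderiv (by simp)).integrable_of_hasCompactSupport
      (hu.hasCompactSupport.fderiv ℝ)
  have h := congrFun (Real.fourier_fderiv hu.integrable
    (hu.contDiff.differentiable (by simp)) hd) ξ
  have h2 := Real.fourier_continuousLinearMap_apply (f := fderiv ℝ u)
    (a := EuclideanSpace.single a (1 : ℝ)) (v := ξ) hd
  rw [h] at h2
  rw [show 𝓕 (_root_.partialD a u) ξ =
    𝓕 (fun x => fderiv ℝ u x (EuclideanSpace.single a 1)) ξ from rfl, ← h2]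
  rw [VectorFourier.fourierSMulRight_apply, _root_.neg_apply,
    _root_.neg_apply, innerSL_single]
  simp
  ring

theorem IsTest.partialD_fracLaplacian (hu : IsTest u) {s : ℝ} (hs : 0 ≤ s) (a : Fin N) :
    _root_.partialD a (fracLaplacian s u) = fracLaplacian s (_root_.partialD a u) := by
  have hi := hu.integrable_fracSymbol hs
  have hi1 : Integrable fun ξ => ‖ξ‖ * ‖fracSymbol s u ξ‖ := by
    simpa using hu.integrable_pow_mul_fracSymbol hs 1
  ext x
  have hd := (Real.hasFDerivAt_fourier hi hi1 (-x)).comp x (hasFDerivAt_id x).neg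
  have hint : Integrable (VectorFourier.fourierSMulRight (innerSL ℝ) (fracSymbol s u)) := by
    refine (hi1.const_mul (2 * Real.pi)).mono'
      hi.aestronglyMeasurable.fourierSMulRight (Eventually.of_forall fun ξ => ?_)
    refine (VectorFourier.norm_fourierSMulRight_le _ _ _).trans ?_
    have := norm_innerSL_le ℝ (E := Euc N)
    calc 2 * Real.pi * ‖innerSL ℝ (E := Euc N)‖ * ‖ξ‖ * ‖fracSymbol s u ξ‖
        ≤ 2 * Real.pi * 1 * ‖ξ‖ * ‖fracSymbol s u ξ‖ := by gcongr
      _ = _ := by ring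
  have hfun : fracLaplacian s u = 𝓕 (fracSymbol s u) ∘ Neg.neg := fracLaplacian_eq s u
  rw [_root_.partialD, hfun, hd.fderiv, fracLaplacian_eq]
  simp only [ContinuousLinearMap.comp_apply, _root_.neg_apply,
    ContinuousLinearMap.id_apply, map_neg]
  rw [Real.fourier_continuousLinearMap_apply hint]
  simp only [Real.fourier_eq]
  rw [← integral_neg]
  congr 1
  ext ξ
  rw [← smul_neg, fracSymbol, hu.fourier_partialD, VectorFourier.fourierSMulRight_apply,
    innerSL_single]
  congr 1
  simp [fracSymbol]
  ring

theorem IsTest.fourier_lapl (hu : IsTest u) (ξ : Euc N) :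
    𝓕 (_root_.lapl u) ξ = -(((2 * Real.pi * ‖ξ‖) ^ 2 : ℝ) : ℂ) * 𝓕 u ξ := by
  have h : 𝓕 (_root_.lapl u) ξ = ∑ a, 𝓕 (_root_.partialD a (_root_.partialD a u)) ξ := by
    simp only [Real.fourier_eq, _root_.lapl, Finset.smul_sum]
    exact integral_finsetSum _ fun a _ =>
      (Real.fourierIntegral_convergent_iff ξ).2 ((hu.partialD a).partialD a).integrable
  rw [h]
  simp only [(hu.partialD _).fourier_partialD, hu.fourier_partialD]
  rw [mul_pow, EuclideanSpace.real_norm_sq_eq]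
  push_cast
  rw [Finset.mul_sum, ← Finset.sum_neg_distrib, Finset.sum_mul]
  refine Finset.sum_congr rfl fun a _ => ?_
  linear_combination (4 * Real.pi ^ 2 * (ξ a : ℂ) ^ 2 * 𝓕 u ξ) * Complex.I_sq

/-- The iterates of `-Δ`. -/
noncomputable def negLaplIter (m : ℕ) (f : Euc N → F) : Euc N → F :=
  (fun g x => (-1 : ℝ) • lapl g x)^[m] f

theorem negLaplIter_succ (m : ℕ) (f : Euc N → F) :
    negLaplIter (m + 1) f = fun x => (-1 : ℝ) • lapl (negLaplIter m f) x := by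
  rw [negLaplIter, Function.iterate_succ_apply']
  rfl

theorem IsTest.const_smul {v : Euc N → F} (hv : IsTest v) (c : ℝ) : IsTest fun x => c • v x :=
  ⟨contDiff_const.smul hv.contDiff, hv.hasCompactSupport.smul_left⟩

theorem IsTest.negLaplIter {v : Euc N → F} (hv : IsTest v) (m : ℕ) : IsTest (negLaplIter m v) := by
  induction m with
  | zero => exact hv
  | succ m ih => rw [negLaplIter_succ]; exact ih.lapl.const_smul _

theorem IsTest.fourier_negLaplIter (hu : IsTest u) (m : ℕ) (ξ : Euc N) :
    𝓕 (_root_.negLaplIter m u) ξ = (((2 * Real.pi * ‖ξ‖) ^ (2 * m) : ℝ) : ℂ) * 𝓕 u ξ := by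
  induction m with
  | zero => simp [_root_.negLaplIter]
  | succ m ih =>
    have h : 𝓕 (_root_.negLaplIter (m + 1) u) ξ = -𝓕 (_root_.lapl (_root_.negLaplIter m u)) ξ := by
      rw [negLaplIter_succ]
      simp only [Real.fourier_eq, neg_one_smul, smul_neg, integral_neg]
    rw [h, (hu.negLaplIter m).fourier_lapl, ih]
    push_cast
    ring

/-- Leaves only the orders 0 and 1/2 to be treated among all half-integers. -/
theorem IsTest.fracLaplacian_add_nat (hu : IsTest u) {s : ℝ} (hs : 0 ≤ s) (m : ℕ) :
    fracLaplacian (s + m) u = fracLaplacian s (_root_.negLaplIter m u) := by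
  rw [fracLaplacian, fracLaplacian]
  congr 1
  ext ξ
  rw [hu.fourier_negLaplIter, ← mul_assoc, mul_add, Real.rpow_add_of_nonneg (by positivity)
    (by positivity) (by positivity), show (2 : ℝ) * m = (2 * m : ℕ) by push_cast; ring,
    Real.rpow_natCast]
  push_cast
  ring

theorem IsTest.fracLaplacian_nat (hu : IsTest u) (m : ℕ) :
    fracLaplacian (m : ℝ) u = _root_.negLaplIter m u := by
  have h := hu.fracLaplacian_add_nat le_rfl m
  rw [zero_add] at h
  rw [h, fracLaplacian]
  simp only [mul_zero, Real.rpow_zero, Complex.ofReal_one, one_mul]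
  exact (hu.negLaplIter m).fourierInv_fourier

end FourierSide

/-! ### Integrability of (-Δ)^(n/2) u, through a singular integral for (-Δ)^(1/2). -/

section HalfLaplacian

open Set MeasureTheory Filter Topology

variable {N : ℕ}

/-- An integrable weight, which behaves like `|y|^(1-N)` at the origin and like `|y|^(-N-1)` at
infinity. -/
noncomputable def halfWeight (y : Euc N) : ℝ := min 1 (‖y‖ ^ 2) * normPow (-((N : ℝ) + 1)) y

theorem normPow_nonneg (s : ℝ) (y : Euc N) : 0 ≤ normPow s y := Real.rpow_nonneg (norm_nonneg _) _

theorem halfWeight_nonneg (y : Euc N) : 0 ≤ halfWeight y :=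
  mul_nonneg (le_min zero_le_one (by positivity)) (normPow_nonneg _ _)

theorem measurable_halfWeight : Measurable (halfWeight : Euc N → ℝ) :=
  (measurable_const.min (measurable_norm.pow_const 2)).mul (measurable_normPow _)

theorem integrable_halfWeight (hN : 1 ≤ N) : Integrable (halfWeight : Euc N → ℝ) := by
  have hfin : Module.finrank ℝ (Euc N) = N := finrank_euclideanSpace_fin
  have h1 : IntegrableOn (halfWeight : Euc N → ℝ) (Metric.ball 0 1) := by
    refine integrableOn_ball_of_norm_le_rpow (by rw [hfin]; exact hN) (C := 1) (α := N - 1)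
      (by rw [hfin]; linarith) (Eventually.of_forall fun x => ?_)
      measurable_halfWeight.aestronglyMeasurable
    rw [Real.norm_of_nonneg (halfWeight_nonneg x), halfWeight, one_mul]
    rcases eq_or_ne x 0 with rfl | hx
    · simp
      positivity
    · refine (mul_le_mul_of_nonneg_right (min_le_right _ _) (normPow_nonneg _ _)).trans (le_of_eq ?_)
      rw [normPow, ← Real.rpow_natCast, ← Real.rpow_add (norm_pos_iff.2 hx)]
      congr 1
      push_cast
      ring
  have h2 : IntegrableOn (halfWeight : Euc N → ℝ) (Metric.ball 0 1)ᶜ := by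
    have hi := (integrable_one_add_norm (E := Euc N) (μ := volume) (r := (N : ℝ) + 1)
      (by rw [hfin]; linarith)).const_mul ((2 : ℝ) ^ ((N : ℝ) + 1))
    refine hi.integrableOn.mono' measurable_halfWeight.aestronglyMeasurable.restrict ?_
    refine (ae_restrict_mem measurableSet_ball.compl).mono fun x hx => ?_
    have hx1 : 1 ≤ ‖x‖ := by simpa using hx
    rw [Real.norm_of_nonneg (halfWeight_nonneg x), halfWeight]
    refine (mul_le_of_le_one_left (normPow_nonneg _ _) (min_le_left _ _)).trans ?_
    rw [normPow, Real.rpow_neg (by positivity), Real.rpow_neg (by positivity), ← div_eq_mul_inv,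
      inv_eq_one_div, div_le_div_iff₀ (by positivity) (by positivity), one_mul,
      ← Real.mul_rpow (by norm_num) (by positivity)]
    exact Real.rpow_le_rpow (by positivity) (by linarith) (by positivity)
  rw [← integrableOn_univ, ← union_compl_self (Metric.ball (0 : Euc N) 1)]
  exact h1.union h2

/-- The integrand of the singular integral representing `|ξ|`. -/
noncomputable def halfKernelIntegrand (ξ y : Euc N) : ℝ :=
  (2 - 2 * Real.cos (2 * Real.pi * inner ℝ y ξ)) * normPow (-((N : ℝ) + 1)) y

/-- The symbol `∫ (2 - 2 cos (2π y·ξ)) |y|^(-N-1) dy`. -/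
noncomputable def halfKernel (ξ : Euc N) : ℝ := ∫ y, halfKernelIntegrand ξ y

theorem halfKernelIntegrand_nonneg (ξ y : Euc N) : 0 ≤ halfKernelIntegrand ξ y :=
  mul_nonneg (by linarith [Real.cos_le_one (2 * Real.pi * inner ℝ y ξ)]) (normPow_nonneg _ _)

theorem halfKernelIntegrand_le (ξ y : Euc N) :
    halfKernelIntegrand ξ y ≤ 4 * Real.pi ^ 2 * (1 + ‖ξ‖ ^ 2) * halfWeight y := by
  rw [halfWeight, ← mul_assoc]
  refine mul_le_mul_of_nonneg_right ?_ (normPow_nonneg _ _)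
  have hpi : 1 ≤ Real.pi ^ 2 := by nlinarith [Real.pi_gt_three]
  rcases le_total 1 (‖y‖ ^ 2) with h | h
  · rw [min_eq_left h, mul_one]
    have := Real.neg_one_le_cos (2 * Real.pi * inner ℝ y ξ)
    nlinarith [sq_nonneg ‖ξ‖, mul_nonneg (sq_nonneg Real.pi) (sq_nonneg ‖ξ‖)]
  · rw [min_eq_right h]
    have h1 := Real.one_sub_sq_div_two_le_cos (x := 2 * Real.pi * inner ℝ y ξ)
    have h2 : (inner ℝ y ξ) ^ 2 ≤ ‖y‖ ^ 2 * ‖ξ‖ ^ 2 := by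
      rw [← mul_pow, ← sq_abs]
      exact pow_le_pow_left₀ (abs_nonneg _) (abs_real_inner_le_norm y ξ) 2
    have h3 : Real.pi ^ 2 * (inner ℝ y ξ) ^ 2 ≤ Real.pi ^ 2 * (‖y‖ ^ 2 * ‖ξ‖ ^ 2) := by gcongr
    have h4 : 0 ≤ Real.pi ^ 2 * ‖y‖ ^ 2 := by positivity
    nlinarith

theorem measurable_halfKernelIntegrand :
    Measurable fun p : Euc N × Euc N => halfKernelIntegrand p.1 p.2 := by
  have h : Continuous fun p : Euc N × Euc N =>
      2 - 2 * Real.cos (2 * Real.pi * inner ℝ p.2 p.1) := by fun_prop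
  exact h.measurable.mul ((measurable_normPow _).comp measurable_snd)

theorem integrable_halfKernelIntegrand (hN : 1 ≤ N) (ξ : Euc N) :
    Integrable (halfKernelIntegrand ξ) := by
  refine ((integrable_halfWeight hN).const_mul (4 * Real.pi ^ 2 * (1 + ‖ξ‖ ^ 2))).mono'
    (measurable_halfKernelIntegrand.comp measurable_prodMk_left).aestronglyMeasurable
    (Eventually.of_forall fun y => ?_)
  rw [Real.norm_of_nonneg (halfKernelIntegrand_nonneg _ _)]
  exact halfKernelIntegrand_le ξ y

theorem halfKernel_smul {c : ℝ} (hc : 0 < c) (ξ : Euc N) :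
    halfKernel (c • ξ) = c * halfKernel ξ := by
  have h := Measure.integral_comp_smul (volume : Measure (Euc N)) (halfKernelIntegrand ξ) c
  rw [finrank_euclideanSpace_fin] at h
  have h2 : ∀ y : Euc N, halfKernelIntegrand ξ (c • y) =
      c ^ (-((N : ℝ) + 1)) * halfKernelIntegrand (c • ξ) y := by
    intro y
    rw [halfKernelIntegrand, halfKernelIntegrand, normPow, normPow, norm_smul,
      Real.norm_of_nonneg hc.le, Real.mul_rpow hc.le (norm_nonneg _), real_inner_smul_left,
      real_inner_smul_right]
    ring
  simp only [h2] at h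
  rw [integral_const_mul, abs_of_nonneg (by positivity), smul_eq_mul, Real.rpow_neg hc.le,
    Real.rpow_add hc, Real.rpow_natCast, Real.rpow_one] at h
  change (c ^ N * c)⁻¹ * halfKernel (c • ξ) = (c ^ N)⁻¹ * halfKernel ξ at h
  have : c ^ N ≠ 0 := by positivity
  field_simp at h
  linarith

theorem halfKernel_isometry (T : Euc N ≃ₗᵢ[ℝ] Euc N) (ξ : Euc N) :
    halfKernel (T ξ) = halfKernel ξ := by
  rw [halfKernel, ← T.measurePreserving.integral_comp T.toMeasurableEquiv.measurableEmbedding]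
  congr 1
  ext y
  simp [halfKernelIntegrand, normPow]

/-- The symbol is homogeneous of degree one and invariant under isometries, and a reflection carries
ξ/|ξ| to a fixed unit vector e. For positivity, the cosine equals -1 at y = e/2, so the integrand is
positive on a nonempty open set. -/
theorem halfKernel_eq (hN : 1 ≤ N) : ∃ κ : ℝ, 0 < κ ∧ ∀ ξ : Euc N, halfKernel ξ = κ * ‖ξ‖ := by
  set e : Euc N := EuclideanSpace.single ⟨0, hN⟩ 1 with he
  have hnorm : ‖e‖ = 1 := by simp [he]
  refine ⟨halfKernel e, ?_, fun ξ => ?_⟩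
  · rw [halfKernel, integral_pos_iff_support_of_nonneg (halfKernelIntegrand_nonneg e)
      (integrable_halfKernelIntegrand hN e)]
    have hopen : IsOpen {y : Euc N | y ≠ 0 ∧ Real.cos (2 * Real.pi * inner ℝ y e) < 1} :=
      isOpen_compl_singleton.inter (isOpen_lt
        (f := fun y : Euc N => Real.cos (2 * Real.pi * inner ℝ y e)) (by fun_prop) continuous_const)
    have hne : ((1 / 2 : ℝ) • e) ∈ {y : Euc N | y ≠ 0 ∧ Real.cos (2 * Real.pi * inner ℝ y e) < 1} := by
      refine ⟨smul_ne_zero (by norm_num) (norm_ne_zero_iff.1 (by rw [hnorm]; norm_num)), ?_⟩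
      rw [real_inner_smul_left, real_inner_self_eq_norm_sq, hnorm,
        show 2 * Real.pi * (1 / 2 * 1 ^ 2) = Real.pi by ring, Real.cos_pi]
      norm_num
    refine (hopen.measure_pos volume ⟨_, hne⟩).trans_le (measure_mono fun y hy => ?_)
    exact (mul_pos (by linarith [hy.2]) (normPow_pos hy.1 _)).ne'
  · rcases eq_or_ne ξ 0 with rfl | hξ
    · simp [halfKernel, halfKernelIntegrand]
    · have hpos : 0 < ‖ξ‖ := norm_pos_iff.2 hξ
      have h1 : ‖‖ξ‖⁻¹ • ξ‖ = ‖e‖ := by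
        rw [norm_smul, norm_inv, norm_norm, inv_mul_cancel₀ hpos.ne', hnorm]
      have h2 := halfKernel_isometry (Submodule.reflection (Submodule.span ℝ {‖ξ‖⁻¹ • ξ - e})ᗮ)
        (‖ξ‖⁻¹ • ξ)
      rw [Submodule.reflection_sub h1] at h2
      rw [h2, mul_comm, ← halfKernel_smul hpos, smul_smul, mul_inv_cancel₀ hpos.ne', one_smul]

variable {v : Euc N → ℂ}

theorem IsTest.eq_integral_fourierChar (hv : IsTest v) (x : Euc N) :
    v x = ∫ ξ, Real.fourierChar (inner ℝ ξ x) • 𝓕 v ξ := by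
  conv_lhs => rw [← hv.fourierInv_fourier]
  exact Real.fourierInv_eq _ _

theorem IsTest.integrable_fourierChar_smul (hv : IsTest v) (x : Euc N) :
    Integrable fun ξ => Real.fourierChar (inner ℝ ξ x) • 𝓕 v ξ := by
  have := (Real.fourierIntegral_convergent_iff (-x)).2 hv.integrable_fourier
  simpa using this

theorem fourierChar_second_difference (ξ x y : Euc N) (c : ℂ) :
    Real.fourierChar (inner ℝ ξ x) • (((2 - 2 * Real.cos (2 * Real.pi * inner ℝ y ξ) : ℝ) : ℂ) * c) =
      (2 : ℂ) * (Real.fourierChar (inner ℝ ξ x) • c) - Real.fourierChar (inner ℝ ξ (x + y)) • c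
        - Real.fourierChar (inner ℝ ξ (x - y)) • c := by
  simp only [Circle.smul_def, Real.fourierChar_apply, smul_eq_mul, inner_add_right, inner_sub_right,
    real_inner_comm ξ y]
  push_cast
  rw [Complex.cos, show 2 * (Real.pi : ℂ) * ((inner ℝ ξ x : ℝ) + (inner ℝ ξ y : ℝ)) * Complex.I =
    2 * Real.pi * (inner ℝ ξ x : ℝ) * Complex.I + 2 * Real.pi * (inner ℝ ξ y : ℝ) * Complex.I by ring,
    show 2 * (Real.pi : ℂ) * ((inner ℝ ξ x : ℝ) - (inner ℝ ξ y : ℝ)) * Complex.I =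
    2 * Real.pi * (inner ℝ ξ x : ℝ) * Complex.I + -(2 * Real.pi * (inner ℝ ξ y : ℝ)) * Complex.I by ring,
    Complex.exp_add, Complex.exp_add]
  ring

theorem IsTest.integral_second_difference (hv : IsTest v) (x y : Euc N) :
    ∫ ξ, Real.fourierChar (inner ℝ ξ x) •
      (((2 - 2 * Real.cos (2 * Real.pi * inner ℝ y ξ) : ℝ) : ℂ) * 𝓕 v ξ) =
      2 * v x - v (x + y) - v (x - y) := by
  simp only [fourierChar_second_difference]
  have h₀ := (hv.integrable_fourierChar_smul x).const_mul (2 : ℂ)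
  have h₁ := hv.integrable_fourierChar_smul (x + y)
  have h₂ := hv.integrable_fourierChar_smul (x - y)
  have h₀₁ : Integrable fun ξ => (2 : ℂ) * (Real.fourierChar (inner ℝ ξ x) • 𝓕 v ξ) -
      Real.fourierChar (inner ℝ ξ (x + y)) • 𝓕 v ξ := h₀.sub h₁
  rw [integral_sub h₀₁ h₂, integral_sub h₀ h₁, integral_const_mul,
    ← hv.eq_integral_fourierChar, ← hv.eq_integral_fourierChar, ← hv.eq_integral_fourierChar]

/-- The half Laplacian as a singular integral. -/
theorem IsTest.halfLaplacian_eq (hN : 1 ≤ N) (hv : IsTest v) : ∃ c : ℂ, ∀ x,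
    fracLaplacian (1 / 2) v x = c * ∫ y, (normPow (-((N : ℝ) + 1)) y : ℂ) *
      (2 * v x - v (x + y) - v (x - y)) := by
  obtain ⟨κ, hκ, hker⟩ := halfKernel_eq hN
  refine ⟨2 * Real.pi / κ, fun x => ?_⟩
  set G : Euc N → Euc N → ℂ := fun ξ y =>
    (halfKernelIntegrand ξ y : ℂ) * (Real.fourierChar (inner ℝ ξ x) • 𝓕 v ξ) with hG
  have hmeasG : AEStronglyMeasurable (Function.uncurry G) (volume.prod volume) := by
    refine (Complex.measurable_ofReal.comp measurable_halfKernelIntegrand).aestronglyMeasurable.mul ?_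
    exact (hv.integrable_fourierChar_smul x).aestronglyMeasurable.comp_fst
  have hmaj : Integrable (fun ξ : Euc N => 4 * Real.pi ^ 2 * (1 + ‖ξ‖ ^ 2) * ‖𝓕 v ξ‖) := by
    have := ((hv.integrable_pow_mul_fourier 0).add (hv.integrable_pow_mul_fourier 2)).const_mul
      (4 * Real.pi ^ 2)
    refine this.congr (Eventually.of_forall fun ξ => ?_)
    simp only [Pi.add_apply]
    ring
  have hintG : Integrable (Function.uncurry G) (volume.prod volume) := by
    refine (hmaj.mul_prod (integrable_halfWeight hN)).mono' hmeasG (Eventually.of_forall ?_)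
    rintro ⟨ξ, y⟩
    simp only [Function.uncurry, hG, norm_mul, Complex.norm_real, Circle.norm_smul,
      Real.norm_of_nonneg (halfKernelIntegrand_nonneg ξ y)]
    calc halfKernelIntegrand ξ y * ‖𝓕 v ξ‖
        ≤ 4 * Real.pi ^ 2 * (1 + ‖ξ‖ ^ 2) * halfWeight y * ‖𝓕 v ξ‖ := by
          gcongr
          exact halfKernelIntegrand_le ξ y
      _ = _ := by ring
  -- Integrating first in y gives the multiplier κ|ξ|; integrating first in ξ gives second
  -- differences of v.
  have hswap := integral_integral_swap hintG
  have hleft : ∀ ξ, ∫ y, G ξ y = (κ * ‖ξ‖ : ℝ) * (Real.fourierChar (inner ℝ ξ x) • 𝓕 v ξ) := by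
    intro ξ
    simp only [hG]
    rw [integral_mul_const, integral_complex_ofReal]
    congr 2
    exact hker ξ
  have hright : ∀ y, ∫ ξ, G ξ y = (normPow (-((N : ℝ) + 1)) y : ℂ) *
      (2 * v x - v (x + y) - v (x - y)) := by
    intro y
    rw [← hv.integral_second_difference, ← integral_const_mul]
    congr 1
    ext ξ
    simp only [hG, halfKernelIntegrand, Circle.smul_def, smul_eq_mul]
    push_cast
    ring
  simp only [hleft, hright] at hswap
  rw [← hswap, fracLaplacian, Real.fourierInv_eq, ← integral_const_mul]
  congr 1
  ext ξ
  have : (κ : ℂ) ≠ 0 := by exact_mod_cast hκ.ne'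
  rw [show 2 * (1 / 2 : ℝ) = 1 by norm_num, Real.rpow_one]
  simp only [Circle.smul_def, smul_eq_mul]
  push_cast
  field_simp

/-- The first-order terms at y and -y cancel, and each Taylor remainder is quadratic because the
derivative of v is Lipschitz. -/
theorem IsTest.norm_second_difference_le (hv : IsTest v) : ∃ C : ℝ, 0 ≤ C ∧ ∀ x y : Euc N,
    ‖2 * v x - v (x + y) - v (x - y)‖ ≤ C * ‖y‖ ^ 2 := by
  obtain ⟨L, hL⟩ := ContDiff.lipschitzWith_of_hasCompactSupport (hv.hasCompactSupport.fderiv ℝ)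
    (hv.contDiff.fderiv_right (m := ∞) (by simp)) (by simp)
  refine ⟨2 * L, by positivity, fun x y => ?_⟩
  have key : ∀ z : Euc N, ‖z‖ = ‖y‖ → ‖v (x + z) - v x - fderiv ℝ v x z‖ ≤ L * ‖y‖ * ‖y‖ := by
    intro z hz
    have h := (convex_closedBall x ‖y‖).norm_image_sub_le_of_norm_fderiv_le' (𝕜 := ℝ) (f := v)
      (φ := fderiv ℝ v x) (C := L * ‖y‖) (x := x) (y := x + z)
      (fun w _ => hv.contDiff.contDiffAt.differentiableAt (by simp)) (fun w hw => ?_)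
      (Metric.mem_closedBall_self (norm_nonneg _)) (by simp [hz])
    · simpa [hz] using h
    · refine (hL.norm_sub_le w x).trans ?_
      gcongr
      simpa [dist_eq_norm] using hw
  have h1 := key y rfl
  have h2 := key (-y) (norm_neg y)
  have : 2 * v x - v (x + y) - v (x - y) = -(v (x + y) - v x - fderiv ℝ v x y) -
      (v (x + -y) - v x - fderiv ℝ v x (-y)) := by
    rw [map_neg, ← sub_eq_add_neg x y]
    ring
  rw [this]
  refine (norm_sub_le _ _).trans ?_
  rw [norm_neg]
  linarith

/-- The integrand of the singular integral is integrable in (x, y) jointly. For |y| ≤ 1 it is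
O(|y|^(1-N)) and supported in a fixed ball in x; for |y| ≥ 1 the three values of v are estimated
separately against |y|^(-N-1). -/
theorem IsTest.integrable_halfLaplacian (hN : 1 ≤ N) (hv : IsTest v) :
    Integrable (fracLaplacian (1 / 2) v) := by
  obtain ⟨c, hc⟩ := hv.halfLaplacian_eq hN
  obtain ⟨C, hC0, hC⟩ := hv.norm_second_difference_le
  obtain ⟨R, hR⟩ := hv.hasCompactSupport.isCompact.isBounded.subset_closedBall (0 : Euc N)
  have hw := integrable_halfWeight hN
  have hwneg : Integrable (fun y : Euc N => halfWeight (-y)) := hw.comp_neg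
  set D : Euc N × Euc N → ℂ := fun p => (normPow (-((N : ℝ) + 1)) p.2 : ℂ) *
    (2 * v p.1 - v (p.1 + p.2) - v (p.1 - p.2)) with hD
  have hcont : Continuous fun p : Euc N × Euc N => 2 * v p.1 - v (p.1 + p.2) - v (p.1 - p.2) := by
    have := hv.contDiff.continuous
    fun_prop
  have hmeas : AEStronglyMeasurable D (volume.prod volume) :=
    ((Complex.measurable_ofReal.comp ((measurable_normPow _).comp measurable_snd)).mul
      hcont.measurable).aestronglyMeasurable
  have i₀ : Integrable (fun p : Euc N × Euc N =>
      (Metric.closedBall (0 : Euc N) (R + 1)).indicator (fun _ => C) p.1 * halfWeight p.2)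
      (volume.prod volume) := by
    refine Integrable.mul_prod ?_ hw
    rw [integrable_indicator_iff measurableSet_closedBall]
    exact integrableOn_const (isCompact_closedBall _ _).measure_lt_top.ne
  have i₁ : Integrable (fun p : Euc N × Euc N => ‖v p.1‖ * halfWeight p.2) (volume.prod volume) :=
    hv.integrable.norm.mul_prod hw
  have i₂ : Integrable (fun p : Euc N × Euc N => halfWeight p.2 * ‖v (p.1 - p.2)‖)
      (volume.prod volume) :=
    hw.convolution_integrand (ContinuousLinearMap.mul ℝ ℝ) hv.integrable.norm
  have i₃ : Integrable (fun p : Euc N × Euc N => halfWeight p.2 * ‖v (p.1 + p.2)‖)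
      (volume.prod volume) := by
    have h := ((MeasurePreserving.id (volume : Measure (Euc N))).prod
      (Measure.measurePreserving_neg (volume : Measure (Euc N)))).integrable_comp_of_integrable i₂
    refine h.congr (Eventually.of_forall fun p => ?_)
    simp [halfWeight, normPow]
  have hint : Integrable D (volume.prod volume) := by
    refine (((i₀.add (i₁.const_mul 2)).add i₃).add i₂).mono' hmeas (Eventually.of_forall ?_)
    rintro ⟨x, y⟩
    have hw0 := normPow_nonneg (-((N : ℝ) + 1)) y
    simp only [hD, norm_mul, Complex.norm_real, Real.norm_of_nonneg hw0, Pi.add_apply]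
    have hb : ‖2 * v x - v (x + y) - v (x - y)‖ ≤ min 1 (‖y‖ ^ 2) *
        ((Metric.closedBall (0 : Euc N) (R + 1)).indicator (fun _ => C) x + 2 * ‖v x‖ +
          ‖v (x + y)‖ + ‖v (x - y)‖) := by
      have htri : ‖2 * v x - v (x + y) - v (x - y)‖ ≤ 2 * ‖v x‖ + ‖v (x + y)‖ + ‖v (x - y)‖ := by
        refine (norm_sub_le _ _).trans (add_le_add_left ((norm_sub_le _ _).trans (le_of_eq ?_)) _)
        simp
      have hind : 0 ≤ (Metric.closedBall (0 : Euc N) (R + 1)).indicator (fun _ => C) x :=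
        indicator_nonneg (fun _ _ => hC0) _
      rcases le_total 1 (‖y‖ ^ 2) with h | h
      · rw [min_eq_left h, one_mul]
        linarith
      · rw [min_eq_right h]
        have hy : ‖y‖ ≤ 1 := by nlinarith [norm_nonneg y]
        by_cases hx : x ∈ Metric.closedBall (0 : Euc N) (R + 1)
        · rw [indicator_of_mem hx]
          have h1 := hC x y
          have h2 : 0 ≤ ‖y‖ ^ 2 * (2 * ‖v x‖ + ‖v (x + y)‖ + ‖v (x - y)‖) := by positivity
          linarith
        -- If |x| > R + 1 and |y| ≤ 1, then x, x + y and x - y all lie outside the support of v.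
        · have hz : ∀ z : Euc N, ‖x - z‖ ≤ 1 → v z = 0 := by
            intro z hxz
            refine image_eq_zero_of_notMem_tsupport fun hz => hx ?_
            have h1 := hR hz
            rw [mem_closedBall_zero_iff] at h1 ⊢
            have := norm_add_le (x - z) z
            rw [sub_add_cancel] at this
            linarith
          rw [hz x (by simp), hz (x + y) (by simpa using hy), hz (x - y) (by simpa using hy)]
          simp only [mul_zero, sub_zero, norm_zero, add_zero]
          positivity
    calc normPow (-((N : ℝ) + 1)) y * ‖2 * v x - v (x + y) - v (x - y)‖
        ≤ normPow (-((N : ℝ) + 1)) y * (min 1 (‖y‖ ^ 2) *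
        ((Metric.closedBall (0 : Euc N) (R + 1)).indicator (fun _ => C) x + 2 * ‖v x‖ +
          ‖v (x + y)‖ + ‖v (x - y)‖)) := by gcongr
      _ = _ := by rw [halfWeight]; ring
  have heq : fracLaplacian (1 / 2) v = fun x => c * ∫ y, D (x, y) := funext hc
  rw [heq]
  exact hint.integral_prod_left.const_mul c

theorem IsTest.integrable_fracLaplacian (hN : 1 ≤ N) (hv : IsTest v) (n : ℕ) :
    Integrable (fracLaplacian ((n : ℝ) / 2) v) := by
  obtain ⟨m, rfl | rfl⟩ := Nat.even_or_odd' n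
  · rw [show ((2 * m : ℕ) : ℝ) / 2 = m by push_cast; ring, hv.fracLaplacian_nat]
    exact (hv.negLaplIter m).integrable
  · rw [show ((2 * m + 1 : ℕ) : ℝ) / 2 = 1 / 2 + m by push_cast; ring,
      hv.fracLaplacian_add_nat (by norm_num)]
    exact (hv.negLaplIter m).integrable_halfLaplacian hN

/-- Partial derivatives commute with the multiplier, so every component of the derivative is again a
fractional Laplacian of a test function. -/
theorem IsTest.integrable_norm_iteratedFDeriv_fracLaplacian (hN : 1 ≤ N) (hv : IsTest v) (n j : ℕ) :
    Integrable fun x => ‖iteratedFDeriv ℝ j (fracLaplacian ((n : ℝ) / 2) v) x‖ := by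
  have hs : 0 ≤ (n : ℝ) / 2 := by positivity
  have hcomp : ∀ j : ℕ, ∀ v : Euc N → ℂ, IsTest v → ∀ i : Fin j → Fin N,
      Integrable fun x => iteratedFDeriv ℝ j (fracLaplacian ((n : ℝ) / 2) v) x
        (fun l => EuclideanSpace.single (i l) (1 : ℝ)) := by
    intro j
    induction j with
    | zero => intro v hv i; simpa using hv.integrable_fracLaplacian hN n
    | succ j ih =>
      intro v hv i
      have h := ih _ (hv.partialD (i (Fin.last j))) (Fin.init i)
      rw [← hv.partialD_fracLaplacian hs] at h
      refine h.congr (Eventually.of_forall fun x => ?_)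
      have := iteratedFDeriv_snoc isOpen_univ (hv.contDiff_fracLaplacian hs).contDiffOn
        (mem_univ x) j (Fin.init i) (i (Fin.last j))
      rw [Fin.snoc_init_self] at this
      exact this.symm
  refine (integrable_finsetSum Finset.univ fun i _ => (hcomp j v hv i).norm).mono'
    ((hv.contDiff_fracLaplacian hs).continuous_iteratedFDeriv
      (by exact_mod_cast le_top)).norm.aestronglyMeasurable (Eventually.of_forall fun x => ?_)
  rw [norm_norm]
  exact norm_multilinear_le_sum _

end HalfLaplacian

/-! ### The Riesz representation by superposition of Gaussians, and the inequality. -/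

section RieszRepresentation

open Set MeasureTheory Filter Topology

variable {N : ℕ}

theorem integral_rpow_mul_exp_neg_sq {p : ℝ} (hp : 0 < p) {x : Euc N} (hx : x ≠ 0) :
    ∫ t in Ioi (0 : ℝ), t ^ (p - 1) * Real.exp (-(‖x‖ ^ 2 * t)) =
      Real.Gamma p * normPow (-(2 * p)) x := by
  have hx0 : 0 < ‖x‖ := norm_pos_iff.2 hx
  rw [Real.integral_rpow_mul_exp_neg_mul_Ioi hp (by positivity), mul_comm, normPow, one_div,
    ← Real.rpow_natCast, ← Real.rpow_neg hx0.le, ← Real.rpow_mul hx0.le]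
  congr 2
  push_cast
  ring

theorem integral_rpow_mul_exp_neg_div {a r : ℝ} (ha : 0 < a) (hr : 0 < r) :
    ∫ t in Ioi (0 : ℝ), t ^ (-a - 1) * Real.exp (-(r / t)) = Real.Gamma a * r ^ (-a) := by
  have h := integral_comp_rpow_Ioi (fun t : ℝ => t ^ (a - 1) * Real.exp (-(r * t)))
    (p := -1) (by norm_num)
  rw [Real.integral_rpow_mul_exp_neg_mul_Ioi ha hr, one_div, Real.inv_rpow hr.le,
    ← Real.rpow_neg hr.le, mul_comm] at h
  rw [← h]
  refine setIntegral_congr_fun measurableSet_Ioi fun t ht => ?_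
  have ht0 : (0 : ℝ) < t := ht
  simp only [abs_neg, abs_one, one_mul, smul_eq_mul]
  rw [← mul_assoc, ← Real.rpow_mul ht0.le, ← Real.rpow_add ht0, Real.rpow_neg_one, div_eq_mul_inv]
  congr 2
  ring

/-- Fubini: since K ≥ 0, absolute integrability on the product is that of κ • g. -/
theorem integral_superposition (hN : 1 ≤ N) {K : Euc N → ℝ → ℝ}
    (hK : Measurable (Function.uncurry K)) (hK0 : ∀ x, ∀ t > 0, 0 ≤ K x t) {κ : Euc N → ℝ}
    (hκ0 : ∀ x ≠ 0, 0 < κ x) (hκ : ∀ x ≠ 0, ∫ t in Ioi 0, K x t = κ x) {g : Euc N → ℂ}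
    (hg : AEStronglyMeasurable g) (hint : Integrable fun x => κ x • g x) :
    ∫ x, κ x • g x = ∫ t in Ioi 0, ∫ x, K x t • g x := by
  have hKi : ∀ x ≠ 0, IntegrableOn (K x) (Ioi 0) := by
    intro x hx
    -- A non-integrable function has Bochner integral 0, whereas κ x > 0.
    by_contra h
    exact (hκ0 x hx).ne' ((hκ x hx).symm.trans (integral_undef h))
  have hprod : Integrable (Function.uncurry fun x t => K x t • g x)
      (volume.prod (volume.restrict (Ioi 0))) := by
    have hm : AEStronglyMeasurable (Function.uncurry fun x t => K x t • g x)
        (volume.prod (volume.restrict (Ioi 0))) := hK.aestronglyMeasurable.smul hg.comp_fst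
    rw [integrable_prod_iff hm]
    constructor
    · filter_upwards [ae_ne_zero hN] with x hx
      exact (hKi x hx).smul_const (g x)
    · refine hint.norm.congr ?_
      filter_upwards [ae_ne_zero hN] with x hx
      simp only [Function.uncurry, norm_smul]
      rw [integral_mul_const, Real.norm_of_nonneg (hκ0 x hx).le, ← hκ x hx]
      congr 1
      exact setIntegral_congr_fun measurableSet_Ioi fun t ht =>
        (Real.norm_of_nonneg (hK0 x t ht)).symm
  rw [← integral_integral_swap hprod]
  refine integral_congr_ae ?_
  filter_upwards [ae_ne_zero hN] with x hx
  rw [integral_smul_const, hκ x hx]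

theorem fourier_gaussian_euc {t : ℝ} (ht : 0 < t) (w : Euc N) :
    𝓕 (fun x : Euc N => ((Real.exp (-(‖x‖ ^ 2 * t)) : ℝ) : ℂ)) w =
      (((Real.pi / t) ^ ((N : ℝ) / 2) * Real.exp (-(Real.pi ^ 2 * ‖w‖ ^ 2 / t)) : ℝ) : ℂ) := by
  have h := fourier_gaussian_innerProductSpace (b := (t : ℂ)) (by simpa using ht) w
  rw [finrank_euclideanSpace_fin] at h
  rw [show (fun x : Euc N => ((Real.exp (-(‖x‖ ^ 2 * t)) : ℝ) : ℂ)) =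
    fun v => Complex.exp (-(t : ℂ) * ‖v‖ ^ 2) by ext v; push_cast; congr 1; ring, h]
  push_cast
  rw [Complex.ofReal_cpow (by positivity)]
  push_cast
  congr 2
  ring

theorem integrable_gaussian_euc {t : ℝ} (ht : 0 < t) :
    Integrable fun x : Euc N => ((Real.exp (-(‖x‖ ^ 2 * t)) : ℝ) : ℂ) := by
  have h := GaussianFourier.integrable_cexp_neg_mul_sq_norm_add (V := Euc N) (b := (t : ℂ))
    (by simpa using ht) 0 0
  refine h.congr (Eventually.of_forall fun v => ?_)
  simp only [zero_mul, add_zero]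
  push_cast
  congr 1
  ring

variable {u : Euc N → ℂ}

/-- The Fourier transform is moved from the symbol to the Gaussian; the reflection distinguishing
`𝓕⁻` from `𝓕` disappears because the Gaussian is even. -/
theorem IsTest.integral_gaussian_fracLaplacian (hu : IsTest u) {s : ℝ} (hs : 0 ≤ s) {t : ℝ}
    (ht : 0 < t) : ∫ x, Real.exp (-(‖x‖ ^ 2 * t)) • fracLaplacian s u x =
      ∫ ξ, ((Real.pi / t) ^ ((N : ℝ) / 2) * Real.exp (-(Real.pi ^ 2 * ‖ξ‖ ^ 2 / t))) •
        fracSymbol s u ξ := by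
  have h := VectorFourier.integral_fourierIntegral_smul_eq_flip (μ := volume) (ν := volume)
    (L := innerₗ (Euc N)) Real.continuous_fourierChar continuous_inner
    (hu.integrable_fracSymbol hs) (integrable_gaussian_euc (N := N) ht)
  rw [flip_innerₗ] at h
  change ∫ ξ, 𝓕 (fracSymbol s u) ξ • ((Real.exp (-(‖ξ‖ ^ 2 * t)) : ℝ) : ℂ) =
    ∫ ξ, fracSymbol s u ξ •
      𝓕 (fun x : Euc N => ((Real.exp (-(‖x‖ ^ 2 * t)) : ℝ) : ℂ)) ξ at h
  rw [← integral_neg_eq_self]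
  simp only [fourier_gaussian_euc ht] at h
  simp only [fracLaplacian_eq, neg_neg, norm_neg, Complex.real_smul]
  simp only [smul_eq_mul] at h
  simp only [mul_comm _ (𝓕 (fracSymbol s u) _), mul_comm _ (fracSymbol s u _)]
  exact h

/-- The representation of `u` as the Riesz potential of its fractional Laplacian. -/
theorem IsTest.integral_riesz (hu : IsTest u) {k : ℕ} (hk : 1 ≤ k) (hkN : k < N) :
    ∫ x, normPow (-k) x • fracLaplacian (((N : ℝ) - k) / 2) u x =
      (rieszGamma N ((N : ℝ) - k) : ℂ) * u 0 := by
  have hN : 1 ≤ N := by omega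
  have hk0 : (0 : ℝ) < k := by exact_mod_cast hk
  have hNk : (0 : ℝ) < N - k := sub_pos.2 (by exact_mod_cast hkN)
  set a : ℝ := ((N : ℝ) - k) / 2 with ha
  have ha0 : 0 < a := by positivity
  have hcast : a = ((N - k : ℕ) : ℝ) / 2 := by rw [Nat.cast_sub hkN.le]
  have hΓk : 0 < Real.Gamma ((k : ℝ) / 2) := Real.Gamma_pos_of_pos (by positivity)
  have hΓa : 0 < Real.Gamma a := Real.Gamma_pos_of_pos ha0
  have hsm := hu.contDiff_fracLaplacian ha0.le
  have hi0 : Integrable (fun x => normPow (-k) x • fracLaplacian a u x) := by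
    have h0 := hu.integrable_norm_iteratedFDeriv_fracLaplacian hN (N - k) 0
    rw [← hcast] at h0
    simp only [norm_iteratedFDeriv_zero] at h0
    refine (integrable_normPow_neg_mul hk0.le (by exact_mod_cast hkN) hsm.continuous.norm h0).mono'
      ((measurable_normPow _).smul hsm.continuous.measurable).aestronglyMeasurable
      (Eventually.of_forall fun x => ?_)
    rw [norm_smul, Real.norm_of_nonneg (normPow_nonneg _ _)]
  have h₁ := integral_superposition hN (κ := fun x => Real.Gamma ((k : ℝ) / 2) * normPow (-k) x)
    (K := fun x t => t ^ ((k : ℝ) / 2 - 1) * Real.exp (-(‖x‖ ^ 2 * t)))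
    (g := fracLaplacian a u)
    (by
      simp only [Function.uncurry_def]
      fun_prop)
    (fun x t ht => by positivity)
    (fun x hx => mul_pos hΓk (normPow_pos hx _))
    (fun x hx => by
      rw [integral_rpow_mul_exp_neg_sq (by positivity) hx, show 2 * ((k : ℝ) / 2) = k by ring])
    hsm.continuous.aestronglyMeasurable
    ((hi0.smul (Real.Gamma ((k : ℝ) / 2))).congr (Eventually.of_forall fun x => by
      simp [mul_assoc]))
  -- The transformed superposition is a multiple of |ξ|^(-2a), which cancels the symbol (2π|ξ|)^(2a)
  -- and leaves a constant times the transform of u.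
  have hsym : ∀ ξ : Euc N, ξ ≠ 0 → (Real.pi ^ ((N : ℝ) / 2) *
      (Real.Gamma a * (Real.pi ^ 2 * ‖ξ‖ ^ 2) ^ (-a))) • fracSymbol a u ξ =
      ((Real.pi ^ ((N : ℝ) / 2) * 2 ^ ((N : ℝ) - k) * Real.Gamma a : ℝ) : ℂ) * 𝓕 u ξ := by
    intro ξ hξ
    have hξ0 : 0 < ‖ξ‖ := norm_pos_iff.2 hξ
    have h2a : (N : ℝ) - k = 2 * a := by rw [ha]; ring
    rw [fracSymbol, Complex.real_smul, ← mul_assoc, ← Complex.ofReal_mul, h2a]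
    congr 2
    have h2 : (2 * Real.pi * ‖ξ‖) ^ (2 * a) = 2 ^ (2 * a) * (Real.pi * ‖ξ‖) ^ (2 * a) := by
      rw [mul_assoc 2, Real.mul_rpow (by norm_num) (by positivity)]
    rw [h2, ← mul_pow, ← Real.rpow_natCast, ← Real.rpow_mul (by positivity)]
    have h1 : (Real.pi * ‖ξ‖) ^ (((2 : ℕ) : ℝ) * -a) * (Real.pi * ‖ξ‖) ^ (2 * a) = 1 := by
      rw [← Real.rpow_add (by positivity)]
      push_cast
      rw [show 2 * -a + 2 * a = 0 by ring, Real.rpow_zero]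
    linear_combination (Real.pi ^ ((N : ℝ) / 2) * Real.Gamma a * 2 ^ (2 * a)) * h1
  have h₂ := integral_superposition hN (κ := fun ξ => Real.pi ^ ((N : ℝ) / 2) *
      (Real.Gamma a * (Real.pi ^ 2 * ‖ξ‖ ^ 2) ^ (-a)))
    (K := fun ξ t => Real.pi ^ ((N : ℝ) / 2) *
      (t ^ (-a - 1) * Real.exp (-(Real.pi ^ 2 * ‖ξ‖ ^ 2 / t))))
    (g := fracSymbol a u)
    (by
      simp only [Function.uncurry_def]
      fun_prop)
    (fun x t ht => by positivity)
    (fun x hx => by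
      have hx0 : 0 < ‖x‖ := norm_pos_iff.2 hx
      positivity)
    (fun x hx => by
      have hx0 : 0 < ‖x‖ := norm_pos_iff.2 hx
      rw [integral_const_mul, integral_rpow_mul_exp_neg_div ha0 (by positivity)])
    (hu.continuous_fracSymbol ha0.le).aestronglyMeasurable
    ((hu.integrable_fourier.const_mul _).congr (by
      filter_upwards [ae_ne_zero hN] with ξ hξ
      exact (hsym ξ hξ).symm))
  have h₃ : ∫ t in Ioi (0 : ℝ), ∫ x, (t ^ ((k : ℝ) / 2 - 1) * Real.exp (-(‖x‖ ^ 2 * t))) •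
      fracLaplacian a u x = ∫ t in Ioi (0 : ℝ), ∫ ξ, (Real.pi ^ ((N : ℝ) / 2) *
      (t ^ (-a - 1) * Real.exp (-(Real.pi ^ 2 * ‖ξ‖ ^ 2 / t)))) • fracSymbol a u ξ := by
    refine setIntegral_congr_fun measurableSet_Ioi fun t ht => ?_
    have ht0 : (0 : ℝ) < t := ht
    simp only [mul_smul (t ^ ((k : ℝ) / 2 - 1))]
    rw [integral_smul, hu.integral_gaussian_fracLaplacian ha0.le ht0, ← integral_smul]
    congr 1
    ext ξ
    rw [smul_smul]
    congr 1
    -- The factor t^(-N/2) of the transformed Gaussian turns the density t^(k/2-1) into t^(-a-1), as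
    -- a = (N - k)/2.
    have hpow : t ^ (-a - 1) = t ^ ((k : ℝ) / 2 - 1) / t ^ ((N : ℝ) / 2) := by
      rw [← Real.rpow_sub ht0]
      congr 1
      rw [ha]
      ring
    rw [Real.div_rpow Real.pi_pos.le ht0.le, hpow]
    ring
  have h₄ : ∫ ξ, (Real.pi ^ ((N : ℝ) / 2) *
      (Real.Gamma a * (Real.pi ^ 2 * ‖ξ‖ ^ 2) ^ (-a))) • fracSymbol a u ξ =
      ((Real.pi ^ ((N : ℝ) / 2) * 2 ^ ((N : ℝ) - k) * Real.Gamma a : ℝ) : ℂ) * u 0 := by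
    have hinv : u 0 = ∫ ξ, 𝓕 u ξ := by
      rw [hu.eq_integral_fourierChar 0]
      simp
    rw [hinv, ← integral_const_mul]
    refine integral_congr_ae ?_
    filter_upwards [ae_ne_zero hN] with ξ hξ
    exact hsym ξ hξ
  rw [h₃, ← h₂, h₄] at h₁
  simp only [mul_smul, integral_smul] at h₁
  rw [Complex.real_smul] at h₁
  have hΓC : ((Real.Gamma ((k : ℝ) / 2) : ℝ) : ℂ) ≠ 0 := by exact_mod_cast hΓk.ne'
  rw [rieszGamma, show ((N : ℝ) - (N - k)) / 2 = k / 2 by ring, ← ha]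
  rw [Complex.ofReal_div, div_mul_eq_mul_div, eq_div_iff hΓC, mul_comm]
  exact h₁

theorem rieszGamma_pos {k : ℕ} (hk : 1 ≤ k) (hkN : k < N) : 0 < rieszGamma N ((N : ℝ) - k) := by
  have hk0 : (0 : ℝ) < k := by exact_mod_cast hk
  have hNk : (0 : ℝ) < N - k := sub_pos.2 (by exact_mod_cast hkN)
  rw [rieszGamma, show ((N : ℝ) - (N - k)) / 2 = k / 2 by ring]
  have h1 := Real.Gamma_pos_of_pos (half_pos hk0)
  have h2 := Real.Gamma_pos_of_pos (half_pos hNk)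
  positivity

/-- The duality formula for the value of a test function at the origin. -/
theorem IsTest.integral_gradPair_fracLaplacian (hu : IsTest u) {k : ℕ} (hk : 1 ≤ k) (hkN : k < N) :
    ∫ x, normPow N x • gradPair k (normPow ((k : ℝ) - N)) (fracLaplacian (((N : ℝ) - k) / 2) u) x =
      ((lambdaConst N ((k : ℝ) - N) k * rieszGamma N ((N : ℝ) - k) : ℝ) : ℂ) * u 0 := by
  have hcast : ((N : ℝ) - k) / 2 = ((N - k : ℕ) : ℝ) / 2 := by rw [Nat.cast_sub hkN.le]
  have hs : (0 : ℝ) ≤ ((N : ℝ) - k) / 2 := by rw [hcast]; positivity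
  rw [integral_gradPair_eq hkN (hu.contDiff_fracLaplacian hs) (fun j _ => by
    rw [hcast]; exact hu.integrable_norm_iteratedFDeriv_fracLaplacian (by omega) (N - k) j),
    hu.integral_riesz hk hkN, Complex.real_smul]
  push_cast
  ring

theorem continuous_tensorNorm {F : Type*} [NormedAddCommGroup F] [NormedSpace ℝ F] (k : ℕ)
    {f : Euc N → F} (hf : ContDiff ℝ ∞ f) : Continuous (tensorNorm k f) := by
  have : Continuous (iteratedFDeriv ℝ k f) :=
    hf.continuous_iteratedFDeriv (by exact_mod_cast le_top)
  unfold tensorNorm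
  fun_prop

theorem integrable_tensorNorm {F : Type*} [NormedAddCommGroup F] [NormedSpace ℝ F] (k : ℕ)
    {f : Euc N → F} (hf : ContDiff ℝ ∞ f) (hi : Integrable fun x => ‖iteratedFDeriv ℝ k f x‖) :
    Integrable (tensorNorm k f) := by
  refine (hi.const_mul (Real.sqrt (N ^ k))).mono'
    (continuous_tensorNorm k hf).aestronglyMeasurable (Eventually.of_forall fun x => ?_)
  rw [Real.norm_of_nonneg (tensorNorm_nonneg _ _ _)]
  exact tensorNorm_le k f x

theorem IsTest.integrable_tensorNorm_fracLaplacian (hu : IsTest u) {k : ℕ} (hkN : k < N) :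
    Integrable (tensorNorm k (fracLaplacian (((N : ℝ) - k) / 2) u)) := by
  have hcast : ((N : ℝ) - k) / 2 = ((N - k : ℕ) : ℝ) / 2 := by rw [Nat.cast_sub hkN.le]
  rw [hcast]
  exact integrable_tensorNorm k (hu.contDiff_fracLaplacian (by positivity))
    (hu.integrable_norm_iteratedFDeriv_fracLaplacian (by omega) (N - k) k)

theorem sharpConst_eq {k : ℕ} (hk : 1 ≤ k) (hkN : k < N) :
    sharpConst N k =
      (Real.sqrt (lambdaConst N ((k : ℝ) - N) k) * rieszGamma N ((N : ℝ) - k))⁻¹ := by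
  have hl := lambdaConst_pos N k hk hkN
  rw [sharpConst, Real.rpow_neg hl.le, ← Real.sqrt_eq_rpow, mul_inv]

/-- Estimates the duality formula by λ γ |u(0)| ≤ √λ ∫ |∇^k (-Δ)^((N-k)/2) u| and divides by √λ. -/
theorem IsTest.norm_zero_le (hu : IsTest u) {k : ℕ} (hk : 1 ≤ k) (hkN : k < N) :
    ‖u 0‖ ≤ sharpConst N k * ∫ x, tensorNorm k (fracLaplacian (((N : ℝ) - k) / 2) u) x := by
  have hl := lambdaConst_pos N k hk hkN
  have hγ := rieszGamma_pos hk hkN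
  have hs : (0 : ℝ) ≤ ((N : ℝ) - k) / 2 :=
    div_nonneg (sub_nonneg.2 (by exact_mod_cast hkN.le)) (by norm_num)
  have h := hu.integral_gradPair_fracLaplacian hk hkN
  have hle : ‖∫ x, normPow N x • gradPair k (normPow ((k : ℝ) - N))
      (fracLaplacian (((N : ℝ) - k) / 2) u) x‖ ≤
      ∫ x, Real.sqrt (lambdaConst N ((k : ℝ) - N) k) *
        tensorNorm k (fracLaplacian (((N : ℝ) - k) / 2) u) x := by
    refine norm_integral_le_of_norm_le ((hu.integrable_tensorNorm_fracLaplacian hkN).const_mul _) ?_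
    filter_upwards [ae_ne_zero (by omega : 1 ≤ N)] with x hx
    exact norm_weighted_gradPair_le k (hu.contDiff_fracLaplacian hs) hx
  rw [h, norm_mul, Complex.norm_real, Real.norm_of_nonneg (by positivity), integral_const_mul] at hle
  rw [sharpConst_eq hk hkN, inv_mul_eq_div, le_div_iff₀ (by positivity)]
  have hsq := Real.sq_sqrt hl.le
  have hsp : 0 < Real.sqrt (lambdaConst N ((k : ℝ) - N) k) := Real.sqrt_pos.2 hl
  refine le_of_mul_le_mul_left ?_ hsp
  rw [← hsq] at hle
  rw [Real.sqrt_sq hsp.le] at hle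
  linarith

theorem fracLaplacian_comp_add_right (s : ℝ) (u : Euc N → ℂ) (b : Euc N) :
    fracLaplacian s (fun x => u (x + b)) = fun x => fracLaplacian s u (x + b) := by
  have h := VectorFourier.fourierIntegral_comp_add_right Real.fourierChar volume
    (innerₗ (Euc N)) u b
  ext x
  rw [fracLaplacian, fracLaplacian, Real.fourierInv_eq, Real.fourierInv_eq]
  congr 1
  ext ξ
  have h1 : 𝓕 (fun x => u (x + b)) ξ = Real.fourierChar (inner ℝ b ξ) • 𝓕 u ξ := congrFun h ξ
  rw [h1, inner_add_right, AddChar.map_add_eq_mul, mul_smul, mul_smul_comm, real_inner_comm b ξ]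

theorem tensorNorm_comp_add_right {F : Type*} [NormedAddCommGroup F] [NormedSpace ℝ F] (k : ℕ)
    (f : Euc N → F) (b x : Euc N) :
    tensorNorm k (fun x => f (x + b)) x = tensorNorm k f (x + b) := by
  simp only [tensorNorm, iteratedFDeriv_comp_add_right]

theorem IsTest.norm_apply_le (hu : IsTest u) {k : ℕ} (hk : 1 ≤ k) (hkN : k < N) (b : Euc N) :
    ‖u b‖ ≤ sharpConst N k * ∫ x, tensorNorm k (fracLaplacian (((N : ℝ) - k) / 2) u) x := by
  have hv : IsTest fun x => u (x + b) :=
    ⟨hu.contDiff.comp (contDiff_id.add contDiff_const),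
      hu.hasCompactSupport.comp_homeomorph (Homeomorph.addRight b)⟩
  have h := hv.norm_zero_le hk hkN
  rw [fracLaplacian_comp_add_right] at h
  simp only [tensorNorm_comp_add_right, zero_add] at h
  rwa [integral_add_right_eq_self
    (tensorNorm k (fracLaplacian (((N : ℝ) - k) / 2) u)) b] at h

end RieszRepresentation

/-! ### Optimality for N - k even. -/

section Optimality

open Set MeasureTheory Filter Topology

variable {N : ℕ} {F : Type*} [NormedAddCommGroup F] [NormedSpace ℝ F]

theorem negLaplIter_congr {U : Set (Euc N)} (hU : IsOpen U) {f g : Euc N → F} (h : EqOn f g U)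
    (m : ℕ) : EqOn (negLaplIter m f) (negLaplIter m g) U := by
  induction m with
  | zero => exact h
  | succ m ih =>
    intro x hx
    simp only [negLaplIter_succ, lapl_congr hU ih hx]

theorem ContDiffOn.negLaplIter {U : Set (Euc N)} (hU : IsOpen U) {f : Euc N → F}
    (hf : ContDiffOn ℝ ∞ f U) (m : ℕ) : ContDiffOn ℝ ∞ (negLaplIter m f) U := by
  induction m with
  | zero => exact hf
  | succ m ih => rw [negLaplIter_succ]; exact contDiffOn_const.smul (ih.lapl hU)

theorem ContDiff.negLaplIter {f : Euc N → F} (hf : ContDiff ℝ ∞ f) (m : ℕ) :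
    ContDiff ℝ ∞ (negLaplIter m f) := by
  rw [← contDiffOn_univ] at hf ⊢
  exact ContDiffOn.negLaplIter isOpen_univ hf m

theorem partialD_comp_smul (c : ℝ) (f : Euc N → F) (a : Fin N) :
    partialD a (fun x => f (c • x)) = fun x => c • partialD a f (c • x) := by
  ext x
  simp only [partialD, fderiv_comp_smul]
  rfl

theorem lapl_comp_smul (c : ℝ) (f : Euc N → F) :
    lapl (fun x => f (c • x)) = fun x => c ^ 2 • lapl f (c • x) := by
  ext x
  simp only [lapl, partialD_comp_smul, partialD_const_smul, Finset.smul_sum, smul_smul, sq]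

theorem negLaplIter_comp_smul (c : ℝ) (f : Euc N → F) (m : ℕ) :
    negLaplIter m (fun x => f (c • x)) = fun x => c ^ (2 * m) • negLaplIter m f (c • x) := by
  induction m with
  | zero => ext x; simp [negLaplIter]
  | succ m ih =>
    ext x
    simp only [negLaplIter_succ, ih, lapl_const_smul, smul_smul]
    rw [lapl_comp_smul c (negLaplIter m f), smul_smul]
    congr 1
    ring

/-- Removes the additive constant log c near the inner truncation; at least one Laplacian is
required. -/
theorem negLaplIter_succ_add_const (m : ℕ) (f : Euc N → F) (b : F) :
    negLaplIter (m + 1) (fun x => f x + b) = negLaplIter (m + 1) f := by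
  have h : ∀ a : Fin N, partialD a (fun x => f x + b) = partialD a f := by
    intro a
    ext x
    simp only [partialD, fderiv_add_const]
  have hl : lapl (fun x => f x + b) = lapl f := by
    ext x
    simp only [lapl, h]
  rw [negLaplIter, negLaplIter, Function.iterate_succ_apply, Function.iterate_succ_apply, hl]

theorem tensorNorm_smul_comp_smul (k : ℕ) (b c : ℝ) {f : Euc N → F} (hf : ContDiff ℝ ∞ f)
    (x : Euc N) :
    tensorNorm k (fun x => b • f (c • x)) x = |b * c ^ k| * tensorNorm k f (c • x) := by
  have hk : ContDiff ℝ k f := hf.of_le (by exact_mod_cast le_top)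
  have h : iteratedFDeriv ℝ k (fun x => b • f (c • x)) x =
      (b * c ^ k) • iteratedFDeriv ℝ k f (c • x) := by
    have h0 : ContDiffAt ℝ k (fun x => f (c • x)) x :=
      (hk.comp (contDiff_const_smul c)).contDiffAt
    rw [iteratedFDeriv_const_smul_apply' h0,
      iteratedFDeriv_comp_const_smul c hk, mul_smul]
  rw [tensorNorm, h, tensorNorm, ← Real.sqrt_sq_eq_abs, ← Real.sqrt_mul (sq_nonneg _),
    Finset.mul_sum]
  congr 1
  refine Finset.sum_congr rfl fun i _ => ?_
  rw [_root_.smul_apply, norm_smul, mul_pow, Real.norm_eq_abs, sq_abs]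

/-! ### Real-valued test functions -/

theorem partialD_ofReal {f : Euc N → ℝ} (hf : ContDiff ℝ ∞ f) (a : Fin N) :
    partialD a (fun x => (f x : ℂ)) = fun x => ((partialD a f x : ℝ) : ℂ) := by
  ext x
  have h := (Complex.ofRealCLM.hasFDerivAt.comp x
    (hf.contDiffAt.differentiableAt (by simp) : DifferentiableAt ℝ f x).hasFDerivAt)
  rw [partialD, show (fun x => (f x : ℂ)) = Complex.ofRealCLM ∘ f from rfl, h.fderiv]
  rfl

theorem lapl_ofReal {f : Euc N → ℝ} (hf : ContDiff ℝ ∞ f) :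
    lapl (fun x => (f x : ℂ)) = fun x => ((lapl f x : ℝ) : ℂ) := by
  ext x
  simp only [lapl, partialD_ofReal hf, partialD_ofReal (hf.partialD _)]
  push_cast
  rfl

theorem negLaplIter_ofReal {f : Euc N → ℝ} (hf : ContDiff ℝ ∞ f) (m : ℕ) :
    negLaplIter m (fun x => (f x : ℂ)) = fun x => ((negLaplIter m f x : ℝ) : ℂ) := by
  induction m with
  | zero => rfl
  | succ m ih =>
    rw [negLaplIter_succ, ih, lapl_ofReal (hf.negLaplIter m), negLaplIter_succ]
    ext x
    simp

theorem gradPair_ofReal (k : ℕ) : ∀ {p f : Euc N → ℝ}, ContDiff ℝ ∞ f →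
    gradPair k p (fun x => (f x : ℂ)) = fun x => ((gradPair k p f x : ℝ) : ℂ) := by
  induction k with
  | zero => intro p f hf; ext x; simp [gradPair]
  | succ k ih =>
    intro p f hf
    ext x
    simp only [gradPair, partialD_ofReal hf]
    push_cast
    refine Finset.sum_congr rfl fun a _ => ?_
    rw [ih (hf.partialD a)]

theorem tensorNorm_ofReal (k : ℕ) {f : Euc N → ℝ} (hf : ContDiff ℝ ∞ f) :
    tensorNorm k (fun x => (f x : ℂ)) = tensorNorm k f := by
  ext x
  have h : iteratedFDeriv ℝ k (fun x => (f x : ℂ)) x =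
      Complex.ofRealCLM.compContinuousMultilinearMap (iteratedFDeriv ℝ k f x) :=
    Complex.ofRealCLM.iteratedFDeriv_comp_left (hf.contDiffAt (x := x)) (i := k)
      (by exact_mod_cast le_top)
  rw [tensorNorm, h, tensorNorm]
  simp

theorem IsTest.ofReal {u : Euc N → ℝ} (hu : IsTest u) : IsTest fun x => (u x : ℂ) :=
  ⟨Complex.ofRealCLM.contDiff.comp hu.contDiff,
    hu.hasCompactSupport.comp_left (g := fun t : ℝ => (t : ℂ)) Complex.ofReal_zero⟩

theorem half_order_eq {k m : ℕ} (hN : N = k + 2 * m) : ((N : ℝ) - k) / 2 = m := by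
  rw [hN]
  push_cast
  ring

/-- Evenness of N - k makes the operator an iterate of -Δ, hence local, so the truncated logarithms
can be examined region by region. -/
theorem IsTest.criticalDensity_eq {u : Euc N → ℝ} (hu : IsTest u) {k m : ℕ} (hN : N = k + 2 * m) :
    criticalDensity N k u = tensorNorm k (_root_.negLaplIter m u) := by
  have h : criticalDensity N k u =
      tensorNorm k (fracLaplacian (((N : ℝ) - k) / 2) fun x => (u x : ℂ)) := rfl
  rw [h, half_order_eq hN, hu.ofReal.fracLaplacian_nat, negLaplIter_ofReal hu.contDiff,
    tensorNorm_ofReal k (hu.contDiff.negLaplIter m)]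

theorem IsTest.integral_gradPair_negLaplIter {u : Euc N → ℝ} (hu : IsTest u) {k m : ℕ}
    (hk : 1 ≤ k) (hm : 1 ≤ m) (hN : N = k + 2 * m) :
    ∫ x, normPow N x • gradPair k (normPow ((k : ℝ) - N)) (_root_.negLaplIter m u) x =
      lambdaConst N ((k : ℝ) - N) k * rieszGamma N ((N : ℝ) - k) * u 0 := by
  have h := hu.ofReal.integral_gradPair_fracLaplacian hk (by omega : k < N)
  rw [half_order_eq hN, hu.ofReal.fracLaplacian_nat, negLaplIter_ofReal hu.contDiff,
    gradPair_ofReal k (hu.contDiff.negLaplIter m)] at h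
  simp only [Complex.real_smul, ← Complex.ofReal_mul] at h
  rw [integral_complex_ofReal] at h
  exact_mod_cast h

/-! ### The logarithmic test functions -/

/-- The fundamental singularity `-log |x|`. -/
noncomputable def negLogNorm (x : Euc N) : ℝ := -Real.log ‖x‖

theorem contDiffOn_negLogNorm : ContDiffOn ℝ ∞ (negLogNorm : Euc N → ℝ) {0}ᶜ := by
  intro x hx
  exact ((contDiffAt_norm ℝ hx).log (norm_ne_zero_iff.2 hx)).neg.contDiffWithinAt

theorem partialD_negLogNorm (a : Fin N) :
    EqOn (partialD a negLogNorm) (fun x : Euc N => (-1 * x a) • normPow (-2) x) {0}ᶜ := by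
  intro x hx
  have hx0 : 0 < ‖x‖ := norm_pos_iff.2 hx
  have h2 : HasFDerivAt (fun y : Euc N => -(1 / 2 * Real.log (‖y‖ ^ 2)))
      (-((1 / 2 : ℝ) • ((‖x‖ ^ 2)⁻¹ • (2 • innerSL ℝ x)))) x :=
    (((hasStrictFDerivAt_norm_sq x).hasFDerivAt.log (by positivity)).const_mul (1 / 2)).neg
  have he : (negLogNorm : Euc N → ℝ) = fun y => -(1 / 2 * Real.log (‖y‖ ^ 2)) := by
    ext y
    rw [negLogNorm, Real.log_pow]
    push_cast
    ring
  simp only [partialD]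
  rw [he, h2.fderiv, normPow, Real.rpow_neg hx0.le, Real.rpow_two]
  simp [EuclideanSpace.inner_single_right]
  ring

theorem lapl_negLogNorm : EqOn (lapl negLogNorm)
    (fun x : Euc N => (2 - (N : ℝ)) • normPow (-2) x) {0}ᶜ := by
  intro x hx
  have hc : ∀ a : Fin N, ContDiffOn ℝ ∞ (fun x : Euc N => -1 * x a) {0}ᶜ := fun a =>
    (contDiff_const.mul (contDiff_coord a)).contDiffOn
  have hterm : ∀ a : Fin N, partialD a (partialD a negLogNorm) x =
      (-1) * normPow (-2) x + 2 * (x a ^ 2 * normPow (-2 - 2) x) := by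
    intro a
    have h1 : partialD a (fun y : Euc N => -1 * y a) x = -1 := by
      have := congrFun (partialD_const_smul (-1) (fun y : Euc N => y a) a) x
      simp only [smul_eq_mul, partialD_coord, if_true, mul_one] at this
      exact this
    rw [partialD_congr isOpen_punctured (partialD_negLogNorm a) a hx,
      partialD_smul isOpen_punctured (hc a) (contDiffOn_normPow _) a hx]
    simp only [smul_eq_mul]
    rw [partialD_normPow (-2) a hx, h1]
    simp only [smul_eq_mul]
    ring
  simp only [lapl, hterm]
  rw [Finset.sum_add_distrib, ← Finset.mul_sum, ← Finset.mul_sum, ← Finset.sum_mul,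
    sum_sq_mul_normPow _ hx]
  simp
  ring

/-- The value of κ is irrelevant: the duality formula supplies the normalization. -/
theorem negLaplIter_negLogNorm (m : ℕ) : ∃ κ : ℝ, EqOn (negLaplIter (m + 1) negLogNorm)
    (fun x : Euc N => κ • normPow (-(2 * (m + 1 : ℕ))) x) {0}ᶜ := by
  induction m with
  | zero =>
    refine ⟨-(2 - (N : ℝ)), fun x hx => ?_⟩
    simp only [negLaplIter_succ]
    rw [show negLaplIter 0 negLogNorm = (negLogNorm : Euc N → ℝ) from rfl, lapl_negLogNorm hx]
    simp
    ring
  | succ m ih =>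
    obtain ⟨κ, hκ⟩ := ih
    refine ⟨-(κ * (-(2 * (m + 1 : ℕ)) * (-(2 * (m + 1 : ℕ)) + N - 2))), fun x hx => ?_⟩
    rw [negLaplIter_succ]
    simp only
    rw [lapl_congr isOpen_punctured hκ hx, lapl_const_smul]
    simp only
    rw [lapl_normPow _ hx]
    simp only [smul_eq_mul]
    push_cast
    rw [show -(2 * ((m : ℝ) + 1)) - 2 = -(2 * (m + 1 + 1)) by ring]
    ring

/-- The function `-log |x|`, cut off near the origin. -/
noncomputable def outerLog (x : Euc N) : ℝ := (1 - stdBump N x) * negLogNorm x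

theorem outerLog_eq_zero {x : Euc N} (hx : ‖x‖ ≤ 1) : outerLog x = 0 := by
  rw [outerLog, stdBump_eq_one hx, sub_self, zero_mul]

theorem outerLog_eq {x : Euc N} (hx : 2 ≤ ‖x‖) : outerLog x = negLogNorm x := by
  rw [outerLog, stdBump_eq_zero hx, sub_zero, one_mul]

theorem contDiff_outerLog : ContDiff ℝ ∞ (outerLog : Euc N → ℝ) := by
  rw [contDiff_iff_contDiffAt]
  intro x
  rcases eq_or_ne x 0 with rfl | hx
  · refine contDiffAt_const (c := (0 : ℝ)) |>.congr_of_eventuallyEq ?_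
    filter_upwards [Metric.ball_mem_nhds (0 : Euc N) one_pos] with y hy
    rw [mem_ball_zero_iff] at hy
    exact outerLog_eq_zero hy.le
  · exact (contDiffAt_const.sub (stdBump N).contDiffAt).mul
      (contDiffOn_negLogNorm.contDiffAt (isOpen_punctured.mem_nhds hx))

/-- A truncation of `-log |x|` at the scales `1 / c` and `1`. -/
noncomputable def truncLog (c : ℝ) (x : Euc N) : ℝ := outerLog (c • x) - outerLog x + Real.log c

theorem negLogNorm_smul {c : ℝ} (hc : 0 < c) {x : Euc N} (hx : x ≠ 0) :
    negLogNorm (c • x) = negLogNorm x - Real.log c := by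
  rw [negLogNorm, negLogNorm, norm_smul, Real.norm_of_nonneg hc.le,
    Real.log_mul hc.ne' (norm_ne_zero_iff.2 hx)]
  ring

theorem truncLog_eq_outer {c : ℝ} (hc : 0 < c) {x : Euc N} (hx : 2 ≤ c * ‖x‖) :
    truncLog c x = negLogNorm x - outerLog x := by
  have hx0 : x ≠ 0 := by
    rintro rfl
    simp at hx
    linarith
  rw [truncLog, outerLog_eq (by rwa [norm_smul, Real.norm_of_nonneg hc.le]), negLogNorm_smul hc hx0]
  ring

theorem truncLog_eq_inner (c : ℝ) {x : Euc N} (hx : ‖x‖ ≤ 1) :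
    truncLog c x = outerLog (c • x) + Real.log c := by
  rw [truncLog, outerLog_eq_zero hx, sub_zero]

theorem isTest_truncLog {c : ℝ} (hc : 1 ≤ c) : IsTest (truncLog c : Euc N → ℝ) := by
  refine ⟨((contDiff_outerLog.comp (contDiff_const_smul c)).sub contDiff_outerLog).add
    contDiff_const, HasCompactSupport.of_support_subset_isCompact
      (isCompact_closedBall (0 : Euc N) 2) fun x hx => ?_⟩
  by_contra h
  rw [mem_closedBall_zero_iff, not_le] at h
  refine hx ?_
  rw [truncLog_eq_outer (by linarith) (by nlinarith), outerLog_eq h.le, sub_self]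

theorem truncLog_zero (c : ℝ) : truncLog c (0 : Euc N) = Real.log c := by
  simp [truncLog]

/-- The `L¹` norm of the derivatives of the truncated logarithms near the inner truncation does not
depend on the scale. -/
theorem setIntegral_inner_tensorNorm {k m : ℕ} (hm : 1 ≤ m) (hN : N = k + 2 * m) {c : ℝ}
    (hc : 6 < c) : ∫ x in Metric.ball (0 : Euc N) (3 / c), tensorNorm k (negLaplIter m (truncLog c)) x =
      ∫ x in Metric.ball (0 : Euc N) 3, tensorNorm k (negLaplIter m outerLog) x := by
  have hc0 : 0 < c := by linarith
  obtain ⟨m, rfl⟩ := Nat.exists_eq_add_of_le' hm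
  -- The dilation factors of the Laplacians and of ∇^k multiply to c^N, which the change of
  -- variables cancels.
  have hpow : c ^ (2 * (m + 1)) * c ^ k = c ^ N := by
    rw [← pow_add]
    congr 1
    omega
  have hball : ∀ x ∈ Metric.ball (0 : Euc N) (3 / c), tensorNorm k (negLaplIter (m + 1) (truncLog c)) x
      = c ^ N * tensorNorm k (negLaplIter (m + 1) outerLog) (c • x) := by
    intro x hx
    have h1 : EqOn (truncLog c) (fun x : Euc N => outerLog (c • x) + Real.log c)
        (Metric.ball 0 (3 / c)) := by
      intro y hy
      rw [mem_ball_zero_iff, lt_div_iff₀ hc0] at hy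
      exact truncLog_eq_inner c (by nlinarith [norm_nonneg y])
    have h2 := negLaplIter_congr Metric.isOpen_ball h1 (m + 1)
    rw [negLaplIter_succ_add_const m (fun x : Euc N => outerLog (c • x)),
      negLaplIter_comp_smul] at h2
    rw [tensorNorm_congr k (eventuallyEq_of_mem (Metric.isOpen_ball.mem_nhds hx) h2),
      tensorNorm_smul_comp_smul k _ _ (contDiff_outerLog.negLaplIter _),
      abs_of_nonneg (by positivity), hpow]
  rw [setIntegral_congr_fun measurableSet_ball hball, integral_const_mul,
    Measure.setIntegral_comp_smul_of_pos volume _ _ hc0, finrank_euclideanSpace_fin,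
    smul_ball hc0.ne', smul_zero, Real.norm_of_nonneg hc0.le, mul_div_cancel₀ _ hc0.ne',
    smul_eq_mul, ← mul_assoc, mul_inv_cancel₀ (by positivity), one_mul]

theorem negLaplIter_truncLog_outer (m : ℕ) {c : ℝ} (hc : 6 < c) :
    EqOn (negLaplIter m (truncLog c))
      (negLaplIter m fun x : Euc N => negLogNorm x - outerLog x) (Metric.closedBall 0 (1 / 2))ᶜ := by
  refine negLaplIter_congr Metric.isClosed_closedBall.isOpen_compl (fun x hx => ?_) m
  rw [mem_compl_iff, mem_closedBall_zero_iff, not_le] at hx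
  exact truncLog_eq_outer (by linarith) (by nlinarith)

theorem negLaplIter_truncLog_middle (m : ℕ) {c : ℝ} (hc : 6 < c) :
    EqOn (negLaplIter m (truncLog c)) (negLaplIter m negLogNorm)
      {x : Euc N | 2 / c < ‖x‖ ∧ ‖x‖ < 1} := by
  have hopen : IsOpen {x : Euc N | 2 / c < ‖x‖ ∧ ‖x‖ < 1} :=
    (isOpen_lt continuous_const continuous_norm).inter (isOpen_lt continuous_norm continuous_const)
  refine negLaplIter_congr hopen (fun x hx => ?_) m
  have h := hx.1
  rw [div_lt_iff₀ (by linarith)] at h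
  rw [truncLog_eq_outer (by linarith) (by linarith), outerLog_eq_zero hx.2.le, sub_zero]

/-- The truncated logarithms almost attain the sharp constant. -/
theorem integral_tensorNorm_truncLog_le {k m : ℕ} (hk : 1 ≤ k) (hm : 1 ≤ m) (hN : N = k + 2 * m) :
    ∃ C : ℝ, ∀ c : ℝ, 6 < c → ∫ x, tensorNorm k (negLaplIter m (truncLog c : Euc N → ℝ)) x ≤
      Real.sqrt (lambdaConst N ((k : ℝ) - N) k) * rieszGamma N ((N : ℝ) - k) * Real.log c + C := by
  have hkN : k < N := by omega
  have hl := lambdaConst_pos N k hk hkN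
  have hγ := rieszGamma_pos (N := N) hk hkN
  set lam := lambdaConst N ((k : ℝ) - N) k with hlam
  set gam := rieszGamma N ((N : ℝ) - k)
  set C₁ := ∫ x in Metric.ball (0 : Euc N) 3, tensorNorm k (negLaplIter m outerLog) x
  set C₂ := ∫ x in (Metric.closedBall (0 : Euc N) (1 / 2))ᶜ,
    tensorNorm k (negLaplIter m fun x : Euc N => negLogNorm x - outerLog x) x
  -- C₁ + C₂ is the exact contribution of the two truncation zones; it is counted once more when
  -- their part of the duality integral is estimated.
  refine ⟨2 * (C₁ + C₂), fun c hc => ?_⟩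
  have hc0 : 0 < c := by linarith
  have hu : IsTest (truncLog c : Euc N → ℝ) := isTest_truncLog (by linarith)
  set f := negLaplIter m (truncLog c : Euc N → ℝ) with hf
  have hfs : IsTest f := hu.negLaplIter m
  have hT : Integrable (tensorNorm k f) := integrable_tensorNorm k hfs.contDiff
    ((hfs.contDiff.continuous_iteratedFDeriv (by exact_mod_cast le_top)).norm
      |>.integrable_of_hasCompactSupport (hfs.hasCompactSupport.iteratedFDeriv k).norm)
  set g : Euc N → ℝ := fun x => normPow N x • gradPair k (normPow ((k : ℝ) - N)) f x with hg
  have hgle : ∀ᵐ x, ‖g x‖ ≤ Real.sqrt lam * tensorNorm k f x := by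
    filter_upwards [ae_ne_zero (by omega : 1 ≤ N)] with x hx
    exact norm_weighted_gradPair_le k hfs.contDiff hx
  have hgm : AEStronglyMeasurable g := by
    have h1 : ContDiffOn ℝ ∞ g {0}ᶜ := (contDiffOn_normPow _).smul
      (ContDiffOn.gradPair isOpen_punctured k (contDiffOn_normPow _) hfs.contDiff.contDiffOn)
    have h2 := h1.continuousOn.aestronglyMeasurable (μ := volume)
      (measurableSet_singleton (0 : Euc N)).compl
    have h3 : (volume : Measure (Euc N)).restrict {0}ᶜ = volume :=
      Measure.restrict_eq_self_of_ae_mem (ae_ne_zero (by omega : 1 ≤ N))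
    rwa [h3] at h2
  have hgi : Integrable g := (hT.const_mul _).mono' hgm hgle
  -- The duality formula, with `truncLog c 0 = log c`.
  have hgint : ∫ x, g x = lam * gam * Real.log c := by
    rw [← truncLog_zero (N := N) c]
    exact hu.integral_gradPair_negLaplIter hk hm hN
  set A : Set (Euc N) := (Metric.closedBall 0 (1 / 2))ᶜ
  set B : Set (Euc N) := Metric.ball 0 (3 / c)
  set M : Set (Euc N) := (A ∪ B)ᶜ
  have hAm : MeasurableSet A := measurableSet_closedBall.compl
  have hBm : MeasurableSet B := measurableSet_ball
  have hMm : MeasurableSet M := (hAm.union hBm).compl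
  -- Here c > 6 is used: it says 3/c < 1/2.
  have hAB : Disjoint A B := by
    refine Set.disjoint_left.2 fun x hx hx' => ?_
    rw [mem_compl_iff, mem_closedBall_zero_iff, not_le] at hx
    rw [mem_ball_zero_iff, lt_div_iff₀ hc0] at hx'
    nlinarith
  have hMc : ∫ x in Mᶜ, tensorNorm k f x = C₁ + C₂ := by
    have hA : ∫ x in A, tensorNorm k f x = C₂ := by
      refine setIntegral_congr_fun hAm fun x hx => ?_
      exact tensorNorm_congr k (eventuallyEq_of_mem
        (Metric.isClosed_closedBall.isOpen_compl.mem_nhds hx) (negLaplIter_truncLog_outer m hc))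
    rw [compl_compl, setIntegral_union hAB hBm hT.integrableOn hT.integrableOn, hA,
      setIntegral_inner_tensorNorm hm hN hc, add_comm]
  -- Equality in Cauchy–Schwarz: on M the function f is κ|x|^(k-N), so its k-th derivatives are
  -- parallel to the dual field and g has constant sign.
  have hM : Real.sqrt lam * ∫ x in M, tensorNorm k f x = |∫ x in M, g x| := by
    obtain ⟨m', rfl⟩ := Nat.exists_eq_add_of_le' hm
    obtain ⟨κ, hκ⟩ := negLaplIter_negLogNorm (N := N) m'
    have hmid : ∀ x ∈ M, x ≠ 0 ∧ f =ᶠ[𝓝 x] fun y => κ • normPow ((k : ℝ) - N) y := by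
      intro x hx
      simp only [M, A, B, mem_compl_iff, mem_union, not_or, not_not, mem_closedBall_zero_iff,
        mem_ball_zero_iff, not_lt] at hx
      have h3 : 2 / c < 3 / c := by gcongr; norm_num
      -- The closed annulus M lies in a larger open one on which no cutoff is active, so f agrees
      -- with the power near each point of M and the derivatives agree too.
      have hx' : x ∈ {x : Euc N | 2 / c < ‖x‖ ∧ ‖x‖ < 1} := ⟨by linarith, by linarith⟩
      have hopen : IsOpen {x : Euc N | 2 / c < ‖x‖ ∧ ‖x‖ < 1} :=
        (isOpen_lt continuous_const continuous_norm).inter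
          (isOpen_lt continuous_norm continuous_const)
      refine ⟨norm_pos_iff.1 (lt_trans (by positivity) hx'.1), ?_⟩
      filter_upwards [hopen.mem_nhds hx'] with y hy
      rw [hf, negLaplIter_truncLog_middle _ hc hy,
        hκ (norm_pos_iff.1 (lt_trans (by positivity) hy.1))]
      simp only
      congr 2
      rw [hN]
      push_cast
      ring
    have hg1 : ∀ x ∈ M, g x = κ * lam * normPow (-N) x := by
      intro x hx
      obtain ⟨hx0, he⟩ := hmid x hx
      obtain ⟨V, hVe, hV, hxV⟩ := eventually_nhds_iff.1 he
      have h1 := gradPair_congr hV k (p := normPow ((k : ℝ) - N)) (fun _ _ => rfl)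
        (fun y hy => hVe y hy) hxV
      rw [gradPair_const_smul_right] at h1
      simp only at h1
      rw [gradPair_normPow k _ _ hx0, ← lambdaConst_eq, ← hlam] at h1
      simp only [smul_eq_mul] at h1
      simp only [hg, smul_eq_mul, h1]
      rw [show -(N : ℝ) = N + (k - N + (k - N) - 2 * k) by ring, ← normPow_mul hx0]
      ring
    have ht1 : ∀ x ∈ M, tensorNorm k f x = |κ| * Real.sqrt lam * normPow (-N) x := by
      intro x hx
      obtain ⟨hx0, he⟩ := hmid x hx
      have hs : iteratedFDeriv ℝ k (fun y : Euc N => κ • normPow ((k : ℝ) - N) y) x =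
          κ • iteratedFDeriv ℝ k (normPow ((k : ℝ) - N) : Euc N → ℝ) x :=
        iteratedFDeriv_const_smul_apply' (((contDiffOn_normPow _).contDiffAt
          (isOpen_punctured.mem_nhds hx0)).of_le (by exact_mod_cast le_top))
      have h2 : tensorNorm k (fun y : Euc N => κ • normPow ((k : ℝ) - N) y) x =
          |κ| * tensorNorm k (normPow ((k : ℝ) - N) : Euc N → ℝ) x := by
        rw [tensorNorm, hs, tensorNorm, ← Real.sqrt_sq_eq_abs, ← Real.sqrt_mul (sq_nonneg _),
          Finset.mul_sum]
        congr 1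
        refine Finset.sum_congr rfl fun i _ => ?_
        rw [_root_.smul_apply, norm_smul, mul_pow, Real.norm_eq_abs κ, sq_abs]
      rw [tensorNorm_congr k he, h2, tensorNorm_normPow k hx0, mul_assoc]
    rw [setIntegral_congr_fun hMm hg1, setIntegral_congr_fun hMm ht1, integral_const_mul,
      integral_const_mul, abs_mul, abs_mul, abs_of_pos hl,
      abs_of_nonneg (integral_nonneg fun x => normPow_nonneg _ x)]
    have hsq := Real.mul_self_sqrt hl.le
    linear_combination (|κ| * ∫ x in M, normPow (-N) x) * hsq
  have hsplit := integral_add_compl hMm hT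
  have hgsplit := integral_add_compl hMm hgi
  have hgc : |∫ x in Mᶜ, g x| ≤ Real.sqrt lam * (C₁ + C₂) := by
    rw [← hMc, ← integral_const_mul]
    exact norm_integral_le_of_norm_le (hT.const_mul _).integrableOn (ae_restrict_of_ae hgle)
  have hlog : 0 ≤ Real.log c := Real.log_nonneg (by linarith)
  have hgM : |∫ x in M, g x| ≤ lam * gam * Real.log c + Real.sqrt lam * (C₁ + C₂) := by
    rw [show ∫ x in M, g x = lam * gam * Real.log c - ∫ x in Mᶜ, g x by linarith]
    refine (abs_sub _ _).trans (add_le_add (le_of_eq (abs_of_nonneg (by positivity))) hgc)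
  rw [← hM] at hgM
  have hsp : 0 < Real.sqrt lam := Real.sqrt_pos.2 hl
  have hsq := Real.mul_self_sqrt hl.le
  have hfin : ∫ x in M, tensorNorm k f x ≤ Real.sqrt lam * gam * Real.log c + (C₁ + C₂) := by
    refine le_of_mul_le_mul_left (hgM.trans (le_of_eq ?_)) hsp
    linear_combination (-(gam * Real.log c)) * hsq
  linarith

end Optimality

/-! ### Assembly of the inequality and its optimality. -/

section Main

open MeasureTheory

theorem IsTest.bddAbove_range_abs {N : ℕ} {u : Euc N → ℝ} (hu : IsTest u) :
    BddAbove (Set.range fun x => |u x|) := by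
  obtain ⟨C, hC⟩ := hu.contDiff.continuous.bounded_above_of_compact_support hu.hasCompactSupport
  exact ⟨C, by rintro _ ⟨x, rfl⟩; exact hC x⟩

theorem IsTest.supAbs_le {N : ℕ} {u : Euc N → ℝ} (hu : IsTest u) {k : ℕ} (hk : 1 ≤ k)
    (hkN : k < N) : supAbs u ≤ sharpConst N k * ∫ x, criticalDensity N k u x := by
  refine ciSup_le fun x => ?_
  have h := hu.ofReal.norm_apply_le hk hkN x
  rw [Complex.norm_real] at h
  exact h

theorem exists_lt_supAbs {N k : ℕ} (hk : 1 ≤ k) (hkN : k < N) (heven : Even (N - k)) {C : ℝ}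
    (hC : C < sharpConst N k) :
    ∃ u : Euc N → ℝ, IsTest u ∧ C * (∫ x, criticalDensity N k u x) < supAbs u := by
  obtain ⟨m, hm⟩ := heven
  have hN : N = k + 2 * m := by omega
  obtain ⟨C₀, hC₀⟩ := integral_tensorNorm_truncLog_le hk (by omega : 1 ≤ m) hN
  have hS : 0 < Real.sqrt (lambdaConst N ((k : ℝ) - N) k) * rieszGamma N ((N : ℝ) - k) :=
    mul_pos (Real.sqrt_pos.2 (lambdaConst_pos N k hk hkN)) (rieszGamma_pos hk hkN)
  rw [sharpConst_eq hk hkN] at hC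
  set S := Real.sqrt (lambdaConst N ((k : ℝ) - N) k) * rieszGamma N ((N : ℝ) - k)
  -- C may be negative; D is nonnegative and still satisfies D S < 1.
  set D := max C 0
  have hDS : D * S < 1 := by
    rw [← lt_inv_mul_iff₀' hS, mul_one]
    exact max_lt hC (inv_pos.2 hS)
  -- The condition on log c is D (S log c + C₀) < log c, solved for log c.
  obtain ⟨c, hc6, hc⟩ : ∃ c : ℝ, 6 < c ∧ D * C₀ / (1 - D * S) < Real.log c :=
    ((Filter.eventually_gt_atTop 6).and
      (Real.tendsto_log_atTop.eventually_gt_atTop (D * C₀ / (1 - D * S)))).exists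
  rw [div_lt_iff₀ (by linarith)] at hc
  have hu : IsTest (truncLog c : Euc N → ℝ) := isTest_truncLog (by linarith)
  have hlog : Real.log c ≤ supAbs (truncLog c : Euc N → ℝ) := by
    refine le_trans ?_ (le_ciSup hu.bddAbove_range_abs 0)
    rw [truncLog_zero]
    exact le_abs_self _
  refine ⟨truncLog c, hu, lt_of_lt_of_le ?_ hlog⟩
  have hint : 0 ≤ ∫ x, criticalDensity N k (truncLog c) x :=
    integral_nonneg fun x => Real.sqrt_nonneg _
  calc C * (∫ x, criticalDensity N k (truncLog c) x)
      ≤ D * (∫ x, criticalDensity N k (truncLog c) x) := by gcongr; exact le_max_left _ _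
    _ ≤ D * (S * Real.log c + C₀) := by
        rw [hu.criticalDensity_eq hN]
        exact mul_le_mul_of_nonneg_left (hC₀ c hc6) (le_max_right _ _)
    _ < Real.log c := by linarith

end Main

theorem theorem1p1 (N k : ℕ) (hk : 1 ≤ k) (hkN : k < N) :
    (∀ u : EuclideanSpace ℝ (Fin N) → ℝ, ContDiff ℝ ∞ u → HasCompactSupport u →
      ContDiff ℝ ∞ (fracLaplacian (((N : ℝ) - k) / 2) (fun x => (u x : ℂ))) ∧
      MeasureTheory.Integrable (criticalDensity N k u) ∧
      supAbs u ≤ sharpConst N k * (∫ x, criticalDensity N k u x)) ∧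
    (Even (N - k) → ∀ C : ℝ, C < sharpConst N k →
      ∃ u : EuclideanSpace ℝ (Fin N) → ℝ, ContDiff ℝ ∞ u ∧ HasCompactSupport u ∧
        C * (∫ x, criticalDensity N k u x) < supAbs u) := by
  refine ⟨fun u hu hs => ?_, fun heven C hC => ?_⟩
  · have ht : IsTest u := ⟨hu, hs⟩
    have h0 : 0 ≤ ((N : ℝ) - k) / 2 := by
      have : (k : ℝ) < N := by exact_mod_cast hkN
      linarith
    exact ⟨ht.ofReal.contDiff_fracLaplacian h0, ht.ofReal.integrable_tensorNorm_fracLaplacian hkN,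
      ht.supAbs_le hk hkN⟩
  · obtain ⟨u, hu, h⟩ := exists_lt_supAbs hk hkN heven hC
    exact ⟨u, hu.contDiff, hu.hasCompactSupport, h⟩
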